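/- Let $d\ge 2$ and $\boldsymbol\lambda=(\lambda_1,\dots,\lambda_d)$ with $\lambda_i>-\tfrac12$, and put $|\boldsymbol\lambda|=\lambda_1+\cdots+\lambda_d$. For $\lambda > -\frac12$ let $w_\lambda(t)=(1-t^2)^{\lambda-1/2}$ on $(-1,1)$ and $c_\lambda=\big(\int_{-1}^1 w_\lambda(t)\,dt\big)^{-1}$, and let $W_{\boldsymbol\lambda}(x)=\prod_{i=1}^d c_{\lambda_i}w_{\lambda_i}(x_i)$ on $[-1,1]^d$. For $\lambda>-\frac12$, $\lambda\neq 0$, let $C_n^\lambda$ be the Gegenbauer polynomial, i.e. the polynomial of degree $n$ that is orthogonal to all polynomials of lower degree with respect to $w_\lambda$ and satisfies $C_n^\lambda(1)=\binom{n+2\lambda-1}{n}$, and let $Z_n^\lambda(t)=\frac{n+\lambda}{\lambda}C_n^\lambda(t)$. Let $\mathcal V_n^d(W_{\boldsymbol\lambda})$ be the space of polynomials of total degree at most $n$ in $d$ variables that are orthogonal, in $L^2([-1,1]^d,W_{\boldsymbol\lambda}(x)\,dx)$, to all polynomials of total degree less than $n$. Let $P_n(W_{\boldsymbol\lambda};x,y)=\sum_{j}P_j^n(x)P_j^n(y)$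 be its reproducing kernel, where $\{P_j^n : 1\le j\le\binom{n+d-1}{n}\}$ is an orthonormal basis of $\mathcal V_n^d(W_{\boldsymbol\lambda})$, and let $$K_n^\delta(W_{\boldsymbol\lambda};x,y)=\frac1{\binom{n+\delta}{n}}\sum_{k=0}^n\binom{n-k+\delta}{n-k}P_k(W_{\boldsymbol\lambda};x,y)$$ be the Cesàro $(C,\delta)$ kernel. Let $\mathbf 1=(1,\dots,1)$, $\sigma_{\boldsymbol\lambda}=\Gamma(|\boldsymbol\lambda|+d)/\prod_{i=1}^d\Gamma(\lambda_i+1)$, and $\mathcal T^d=\{y\in\mathbb R^d: y_i\ge0,\ y_1+\cdots+y_d=1\}$, with $dy=dy_1\cdots dy_{d-1}$. Then for every $n\ge0$ and $x\in[-1,1]^d$ the integrals below converge absolutely, $$P_n(W_{\boldsymbol\lambda};x,\mathbf 1)=\sum_{m=0}^{\min\{\lfloor n/2\rfloor,\,d-1\}}(-1)^m\binom{d-1}{m}\,\sigma_{\boldsymbol\lambda}\int_{\mathcal T^d}Z_{n-2m}^{|\boldsymbol\lambda|+d-1}(\langle x,y\rangle)\prod_{i=1}^d y_i^{\lambda_i}\,dy,$$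 and $$K_n^{d-2}(W_{\boldsymbol\lambda};x,\mathbf 1)=\frac1{\binom{n+d-2}{n}}\sum_{m=0}^{\min\{n,\,d-1\}}\binom{d-1}{m}\,\sigma_{\boldsymbol\lambda}\int_{\mathcal T^d}Z_{n-m}^{|\boldsymbol\lambda|+d-1}(\langle x,y\rangle)\prod_{i=1}^d y_i^{\lambda_i}\,dy.$$ -/

import Mathlib

open scoped BigOperators

noncomputable section

namespace GegenbauerKernel

/-- The Gegenbauer weight `w_λ(t) = (1 - t²)^(λ - 1/2)` on `(-1, 1)`. -/
def weight (lam t : ℝ) : ℝ := (1 - t ^ 2) ^ (lam - 1 / 2)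

/-- The normalization constant `c_λ` of `w_λ`, so that `c_λ ∫_{-1}^1 w_λ = 1`. -/
def weightConst (lam : ℝ) : ℝ := (∫ t in (-1 : ℝ)..1, weight lam t)⁻¹

/-- `p` is the Gegenbauer polynomial of degree `n` and index `λ`: it has degree `n`, is orthogonal
to all polynomials of lower degree with respect to `w_λ`, and `p(1) = binom(n + 2λ - 1, n)`. -/
structure IsGegenbauer (lam : ℝ) (n : ℕ) (p : Polynomial ℝ) : Prop where
  degree_eq : p.degree = n
  orthogonal : ∀ q : Polynomial ℝ, q.degree < n →
    ∫ t in (-1 : ℝ)..1, p.eval t * q.eval t * weight lam t = 0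
  eval_one : p.eval 1 = Ring.choose ((n : ℝ) + 2 * lam - 1) n

/-- The Gegenbauer polynomial `C_n^λ` (it exists and is unique for `λ > -1/2`, `λ ≠ 0`). -/
def gegenbauer (lam : ℝ) (n : ℕ) : Polynomial ℝ := Classical.epsilon (IsGegenbauer lam n)

/-- `Z_n^λ(t) = (n + λ) / λ * C_n^λ(t)`. -/
def zonal (lam : ℝ) (n : ℕ) (t : ℝ) : ℝ := ((n : ℝ) + lam) / lam * (gegenbauer lam n).eval t

/-- The normalized product weight `W_λ(x) = c_λ ∏ w_{λ_i}(x_i)` on `[-1, 1]^d`. -/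
def prodWeight {d : ℕ} (lam : Fin d → ℝ) (x : Fin d → ℝ) : ℝ :=
  (∏ i, weightConst (lam i)) * ∏ i, weight (lam i) (x i)

/-- The inner product `⟨p, q⟩_W` on the cube `[-1, 1]^d`, for polynomials in `d` variables. -/
def polyInner {d : ℕ} (W : (Fin d → ℝ) → ℝ) (p q : MvPolynomial (Fin d) ℝ) : ℝ :=
  ∫ x in Set.Icc (-1 : Fin d → ℝ) 1, MvPolynomial.eval x p * MvPolynomial.eval x q * W x

/-- The space `V_n^d(W)` of orthogonal polynomials of degree `n`: the polynomials of total degree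
at most `n` that are orthogonal to all polynomials of total degree less than `n`. -/
def orthoSpace {d : ℕ} (W : (Fin d → ℝ) → ℝ) (n : ℕ) : Set (MvPolynomial (Fin d) ℝ) :=
  {p | p.totalDegree ≤ n ∧
    ∀ q : MvPolynomial (Fin d) ℝ, q.totalDegree < n → polyInner W p q = 0}

/-- `P` is an orthonormal basis of `V_n^d(W)`, a space of dimension `binom(n + d - 1, n)`. -/
structure IsOrthoBasis {d : ℕ} (W : (Fin d → ℝ) → ℝ) (n : ℕ)
    (P : Fin ((n + d - 1).choose n) → MvPolynomial (Fin d) ℝ) : Prop where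
  mem : ∀ j, P j ∈ orthoSpace W n
  orthonormal : ∀ j k, polyInner W (P j) (P k) = if j = k then 1 else 0
  spans : ∀ p ∈ orthoSpace W n, p ∈ Submodule.span ℝ (Set.range P)

/-- An orthonormal basis `P_1^n, P_2^n, …` of `V_n^d(W)`. -/
def orthoBasis {d : ℕ} (W : (Fin d → ℝ) → ℝ) (n : ℕ) :
    Fin ((n + d - 1).choose n) → MvPolynomial (Fin d) ℝ :=
  Classical.epsilon (IsOrthoBasis W n)

/-- The reproducing kernel `P_n(W; x, y) = ∑_j P_j^n(x) P_j^n(y)` of `V_n^d(W)`; it does not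
depend on the choice of the orthonormal basis. -/
def reproKernel {d : ℕ} (W : (Fin d → ℝ) → ℝ) (n : ℕ) (x y : Fin d → ℝ) : ℝ :=
  ∑ j, MvPolynomial.eval x (orthoBasis W n j) * MvPolynomial.eval y (orthoBasis W n j)

/-- The Cesàro `(C, δ)` kernel
`K_n^δ(W; x, y) = binom(n + δ, n)⁻¹ ∑_{k ≤ n} binom(n - k + δ, n - k) P_k(W; x, y)`. -/
def cesaroKernel {d : ℕ} (W : (Fin d → ℝ) → ℝ) (δ : ℝ) (n : ℕ) (x y : Fin d → ℝ) : ℝ :=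
  1 / Ring.choose ((n : ℝ) + δ) n *
    ∑ k ∈ Finset.range (n + 1),
      Ring.choose (((n - k : ℕ) : ℝ) + δ) (n - k) * reproKernel W k x y

/-- The solid simplex `T^{k} = {y ∈ ℝ^k : y_i ≥ 0, y_1 + ⋯ + y_k ≤ 1}`. -/
def solidSimplex (k : ℕ) : Set (Fin k → ℝ) := {y | (∀ i, 0 ≤ y i) ∧ ∑ i, y i ≤ 1}

/-- The point `(y_1, …, y_{d-1}, 1 - y_1 - ⋯ - y_{d-1})` in homogeneous coordinates. -/
def homCoord {d : ℕ} (y : Fin (d - 1) → ℝ) (i : Fin d) : ℝ :=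
  if h : (i : ℕ) < d - 1 then y ⟨i, h⟩ else 1 - ∑ j, y j

/-- Absolute integrability over the simplex `{y ∈ ℝ^d : y_i ≥ 0, y_1 + ⋯ + y_d = 1}`. -/
def SimplexIntegrable {d : ℕ} (f : (Fin d → ℝ) → ℝ) : Prop :=
  MeasureTheory.IntegrableOn (fun y => f (homCoord y)) (solidSimplex (d - 1))

/-- The integral over `{y ∈ ℝ^d : y_i ≥ 0, y_1 + ⋯ + y_d = 1}` with respect to
`dy = dy_1 ⋯ dy_{d-1}`. -/
def simplexIntegral {d : ℕ} (f : (Fin d → ℝ) → ℝ) : ℝ :=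
  ∫ y in solidSimplex (d - 1), f (homCoord y)

/-- `σ_λ = Γ(|λ| + d) / ∏ Γ(λ_i + 1)`. -/
def sigmaConst {d : ℕ} (lam : Fin d → ℝ) : ℝ :=
  Real.Gamma ((∑ i, lam i) + d) / ∏ i, Real.Gamma (lam i + 1)

/-- The integrand `Z_k^{|λ| + d - 1}(⟨x, y⟩) ∏ y_i^{λ_i}` as a function of `y`. -/
def kernelIntegrand {d : ℕ} (lam : Fin d → ℝ) (k : ℕ) (x y : Fin d → ℝ) : ℝ :=
  zonal ((∑ i, lam i) + d - 1) k (∑ i, x i * y i) * ∏ i, y i ^ lam i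

end GegenbauerKernel

end

open GegenbauerKernel

/-!
The proof compares generating functions in a variable `r`. The one-variable kernels satisfy
`∑ Z_n^λ(t) r^n = (1 - r²) (1 - 2 r t + r²)^(-λ-1)`, and `P_n(W_λ; x, 1)` is the sum of the products
`∏ Z_{α_i}^{λ_i}(x_i)` over `|α| = n`, so that
`∑ P_n(W_λ; x, 1) r^n = (1 - r²)^d ∏ (1 - 2 r x_i + r²)^(-λ_i-1)` (`reproKernelSeries_eq`).
Feynman's parametrization writes the last product as the Dirichlet average over the simplex of
`(∑ y_i (1 - 2 r x_i + r²))^(-|λ|-d) = (1 - 2 r ⟨x, y⟩ + r²)^(-|λ|-d)`, which is, up to a factor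
`1 - r²`, the generating function of the `Z_k^{|λ|+d-1}(⟨x, y⟩)` (`simplexIntegralSeries_eq`).
Hence the generating function of the kernels is `(1 - r²)^(d-1)` times that of the simplex
integrals. For the `(C, d-2)` means it gets multiplied by `(1 - r)^(1-d)`, which leaves the factor
`(1 + r)^(d-1)`. Expanding the two factors gives the two formulas.

All series are formal. `C_n^μ` is defined by its three-term recurrence, from which everything else is
derived. Its expansion in powers of `2 r t - r²` (`ultra_eval_eq_sum`) reduces Feynman's
parametrization to the multinomial theorem and the moments of the Dirichlet distribution
(`sigmaConst_mul_simplexIntegral_monomial`, from `lintegral_dirichlet`).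

Orthogonality of the `Z_n^λ`, and the fact that the squared norm of `Z_n^λ` is `Z_n^λ(1)`, come from
one integration by parts (`mean_zonalPoly_mul`), which lowers `n` and raises `λ` by one
(`mean_zonalPoly_mul_eq_zero`, `mean_zonalPoly_mul_self`). The products `∏ Z_{α_i}^{λ_i}(x_i)` are
therefore an orthogonal basis of the polynomials on the cube, with squared norms equal to their
values at `1`, and the kernel at `y = 1` is their sum (`reproKernel_prodWeight_one`).
-/

namespace GegenbauerKernel

noncomputable section

/-! ### Ultraspherical polynomials and their differential relations -/

section Ultraspherical

open Polynomial

/-- The ultraspherical polynomial `C_n^μ`, defined by its three-term recurrence. -/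
def ultra (mu : ℝ) : ℕ → ℝ[X]
  | 0 => 1
  | 1 => C (2 * mu) * X
  | n + 2 => C (2 * (n + 1 + mu) / (n + 2)) * X * ultra mu (n + 1)
      - C ((n + 2 * mu) / (n + 2)) * ultra mu n

theorem ultra_zero (mu : ℝ) : ultra mu 0 = 1 := by rw [ultra]

theorem ultra_one (mu : ℝ) : ultra mu 1 = C (2 * mu) * X := by rw [ultra]

theorem ultra_rec (mu : ℝ) (n : ℕ) :
    ((n : ℝ[X]) + 2) * ultra mu (n + 2) =
      2 * ((n : ℝ[X]) + 1 + C mu) * X * ultra mu (n + 1) - ((n : ℝ[X]) + 2 * C mu) * ultra mu n := by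
  have h : (n : ℝ) + 2 ≠ 0 := by positivity
  have h0 : ((n : ℝ[X]) + 2) = C ((n : ℝ) + 2) := by simp [map_ofNat]
  have h1 : C ((n : ℝ) + 2) * C (2 * (n + 1 + mu) / (n + 2)) = 2 * (n + 1 + C mu) := by
    rw [← C_mul, mul_div_cancel₀ _ h]; simp [map_ofNat]
  have h2 : C ((n : ℝ) + 2) * C ((n + 2 * mu) / (n + 2)) = n + 2 * C mu := by
    rw [← C_mul, mul_div_cancel₀ _ h]; simp [map_ofNat]
  rw [ultra, h0]
  linear_combination X * ultra mu (n + 1) * h1 - ultra mu n * h2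

/-- The two mixed relations between `C_n^μ` and its derivative prove each other by induction. -/
theorem ultra_derivative_aux (mu : ℝ) (n : ℕ) :
    ((n : ℝ[X]) + 1) * ultra mu (n + 1) =
        X * derivative (ultra mu (n + 1)) - derivative (ultra mu n) ∧
      derivative (ultra mu (n + 1)) =
        X * derivative (ultra mu n) + ((n : ℝ[X]) + 2 * C mu) * ultra mu n := by
  induction n with
  | zero => simp [ultra_zero, ultra_one, map_ofNat]; ring
  | succ n ih =>
    obtain ⟨hA, hB⟩ := ih
    have hrec := ultra_rec mu n
    have hd := congrArg derivative hrec
    have hn : ((n : ℝ[X]) + 2) ≠ 0 := by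
      have : ((n + 2 : ℕ) : ℝ[X]) ≠ 0 := by exact_mod_cast (by omega : n + 2 ≠ 0)
      simpa using this
    simp only [derivative_mul, derivative_sub, derivative_add, derivative_natCast, derivative_C,
      derivative_X, derivative_ofNat, derivative_one] at hd
    have hB' : derivative (ultra mu (n + 2)) =
        X * derivative (ultra mu (n + 1)) + ((n : ℝ[X]) + 1 + 2 * C mu) * ultra mu (n + 1) := by
      apply mul_left_cancel₀ hn
      linear_combination hd - ((n : ℝ[X]) + 2 * C mu) * hA
    refine ⟨?_, by push_cast; exact hB'⟩
    push_cast
    linear_combination hrec - X * hB' + hB + X * hA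

theorem derivative_ultra_succ (mu : ℝ) (n : ℕ) :
    derivative (ultra mu (n + 1)) =
      X * derivative (ultra mu n) + ((n : ℝ[X]) + 2 * C mu) * ultra mu n :=
  (ultra_derivative_aux mu n).2

theorem succ_mul_ultra_succ (mu : ℝ) (n : ℕ) :
    ((n : ℝ[X]) + 1) * ultra mu (n + 1) =
      X * derivative (ultra mu (n + 1)) - derivative (ultra mu n) :=
  (ultra_derivative_aux mu n).1

/-- The lowering relation for the first-order operator `(1 - t²) d/dt`. -/
theorem one_sub_sq_mul_derivative_ultra (mu : ℝ) (n : ℕ) :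
    (1 - X ^ 2) * derivative (ultra mu (n + 1)) =
      ((n : ℝ[X]) + 2 * C mu) * ultra mu n - ((n : ℝ[X]) + 1) * X * ultra mu (n + 1) := by
  linear_combination derivative_ultra_succ mu n + X * succ_mul_ultra_succ mu n

/-- Differentiation raises the index: `(C_{n+1}^μ)' = 2 μ C_n^{μ+1}`. -/
theorem derivative_ultra (mu : ℝ) (n : ℕ) :
    derivative (ultra mu (n + 1)) = 2 * C mu * ultra (mu + 1) n := by
  induction n using Nat.strong_induction_on with
  | _ n ih =>
    match n with
    | 0 => simp [ultra_zero, ultra_one, map_ofNat]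
    | 1 =>
      have h := derivative_ultra_succ mu 1
      simp only [ultra_one, Nat.cast_one] at h ⊢
      rw [h]
      simp
      ring
    | n + 2 =>
      have h0 := ih n (by omega)
      have h1 := ih (n + 1) (by omega)
      have hB := derivative_ultra_succ mu (n + 2)
      have hA := succ_mul_ultra_succ mu (n + 1)
      have hrec := ultra_rec (mu + 1) n
      have hn : ((n : ℝ[X]) + 2) ≠ 0 := by
        have : ((n + 2 : ℕ) : ℝ[X]) ≠ 0 := by exact_mod_cast (by omega : n + 2 ≠ 0)
        simpa using this
      apply mul_left_cancel₀ hn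
      push_cast at hB hA hrec ⊢
      simp only [C_add, C_1] at hrec
      linear_combination ((n : ℝ[X]) + 2) * hB + ((n : ℝ[X]) + 2 + 2 * C mu) * hA
        + (2 * (n : ℝ[X]) + 4 + 2 * C mu) * X * h1 - ((n : ℝ[X]) + 2 + 2 * C mu) * h0
        - 2 * C mu * hrec

/-- The polynomials `Z_n^λ`, with generating function `(1 - r²) / (1 - 2 r t + r²)^(λ + 1)`. This
form makes sense at `λ = 0` as well, where the quotient `(n + λ) / λ * C_n^λ` does not. -/
def zonalPoly (lam : ℝ) : ℕ → ℝ[X]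
  | 0 => 1
  | 1 => ultra (lam + 1) 1
  | n + 2 => ultra (lam + 1) (n + 2) - ultra (lam + 1) n

theorem zonalPoly_zero (lam : ℝ) : zonalPoly lam 0 = 1 := by rw [zonalPoly]

/-- `(n + λ) C_n^λ = λ Z_n^λ`. -/
theorem add_mul_ultra (lam : ℝ) (n : ℕ) :
    ((n : ℝ[X]) + C lam) * ultra lam n = C lam * zonalPoly lam n := by
  match n with
  | 0 => simp [ultra_zero, zonalPoly_zero]
  | 1 => simp [zonalPoly, ultra_one]; ring
  | n + 2 =>
    have hA := succ_mul_ultra_succ lam (n + 1)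
    have hB := derivative_ultra_succ lam (n + 2)
    have h0 := derivative_ultra lam n
    have h2 := derivative_ultra lam (n + 2)
    rw [zonalPoly]
    have h : (2 : ℝ[X]) ≠ 0 := two_ne_zero
    apply mul_left_cancel₀ h
    push_cast at *
    linear_combination hA - hB - h0 + h2

/-- `(Z_{n+1}^λ)' = 2 (n + 1 + λ) C_n^{λ+1}`. -/
theorem derivative_zonalPoly (lam : ℝ) (n : ℕ) :
    derivative (zonalPoly lam (n + 1)) = 2 * ((n : ℝ[X]) + 1 + C lam) * ultra (lam + 1) n := by
  match n with
  | 0 => simp [zonalPoly, ultra_zero, ultra_one, map_ofNat, add_comm]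
  | n + 1 =>
    have hA := succ_mul_ultra_succ (lam + 1) n
    have hB := derivative_ultra_succ (lam + 1) (n + 1)
    rw [zonalPoly, derivative_sub]
    push_cast at *
    simp only [C_add, C_1] at *
    linear_combination -hA + hB

/-- The Rodrigues-type relation: up to a constant, `Z_{n+1}^λ w_λ` is the derivative of
`C_n^{λ+1} w_{λ+1}`. -/
theorem rodrigues_zonalPoly (lam : ℝ) (n : ℕ) :
    2 * ((n : ℝ[X]) + 1 + C lam) * ((1 - X ^ 2) * derivative (ultra (lam + 1) n)
        - (2 * C lam + 1) * X * ultra (lam + 1) n) =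
      -(((n : ℝ[X]) + 1) * ((n : ℝ[X]) + 1 + 2 * C lam) * zonalPoly lam (n + 1)) := by
  match n with
  | 0 => simp [zonalPoly, ultra_zero, ultra_one, map_ofNat, add_comm]; ring
  | n + 1 =>
    have h := one_sub_sq_mul_derivative_ultra (lam + 1) n
    have hrec := ultra_rec (lam + 1) n
    rw [zonalPoly]
    push_cast at *
    simp only [C_add, C_1] at *
    linear_combination 2 * ((n : ℝ[X]) + 2 + C lam) * h + ((n : ℝ[X]) + 2 + 2 * C lam) * hrec

theorem natDegree_ultra_le (mu : ℝ) (n : ℕ) : (ultra mu n).natDegree ≤ n := by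
  induction n using Nat.strong_induction_on with
  | _ n ih =>
    match n with
    | 0 => simp [ultra_zero]
    | 1 => rw [ultra_one]; exact (natDegree_C_mul_le _ _).trans natDegree_X_le
    | n + 2 =>
      have h0 := ih n (by omega)
      have h1 := ih (n + 1) (by omega)
      rw [ultra]
      refine (natDegree_sub_le _ _).trans (max_le ?_ ?_)
      · refine natDegree_mul_le.trans ?_
        have := (natDegree_C_mul_le (2 * ((n : ℝ) + 1 + mu) / (n + 2)) X).trans natDegree_X_le
        omega
      · exact (natDegree_C_mul_le _ _).trans (by omega)

theorem coeff_ultra_pos {mu : ℝ} (hmu : 0 < mu) (n : ℕ) : 0 < (ultra mu n).coeff n := by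
  induction n using Nat.strong_induction_on with
  | _ n ih =>
    match n with
    | 0 => simp [ultra_zero]
    | 1 => simp [ultra_one, hmu]
    | n + 2 =>
      have h1 := ih (n + 1) (by omega)
      have h2 : (ultra mu n).coeff (n + 2) = 0 :=
        coeff_eq_zero_of_natDegree_lt (by have := natDegree_ultra_le mu n; omega)
      rw [ultra, coeff_sub, mul_assoc, coeff_C_mul, coeff_C_mul, h2, mul_zero, sub_zero,
        show n + 2 = (n + 1) + 1 from rfl, coeff_X_mul]
      positivity

theorem natDegree_zonalPoly_le (lam : ℝ) (n : ℕ) : (zonalPoly lam n).natDegree ≤ n := by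
  match n with
  | 0 => simp [zonalPoly_zero]
  | 1 => exact natDegree_ultra_le _ 1
  | n + 2 =>
    refine (natDegree_sub_le _ _).trans (max_le (natDegree_ultra_le _ _) ?_)
    exact (natDegree_ultra_le _ n).trans (by omega)

theorem coeff_zonalPoly_pos {lam : ℝ} (hlam : -1 < lam) (n : ℕ) :
    0 < (zonalPoly lam n).coeff n := by
  have h : 0 < lam + 1 := by linarith
  match n with
  | 0 => simp [zonalPoly_zero]
  | 1 => exact coeff_ultra_pos h 1
  | n + 2 =>
    have h2 : (ultra (lam + 1) n).coeff (n + 2) = 0 :=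
      coeff_eq_zero_of_natDegree_lt (by have := natDegree_ultra_le (lam + 1) n; omega)
    rw [zonalPoly, coeff_sub, h2, sub_zero]
    exact coeff_ultra_pos h _

/-- The index-shifting recursion for `Z_n^λ(1)`, which the squared norms of `Z_n^λ` obey too. -/
theorem zonalPoly_succ_eval_one (lam : ℝ) (n : ℕ) :
    ((n : ℝ) + 1) * (n + 1 + 2 * lam) * (zonalPoly lam (n + 1)).eval 1 =
      2 * (lam + 1) * (2 * lam + 1) * (zonalPoly (lam + 1) n).eval 1 := by
  have h1 := congrArg (eval 1) (rodrigues_zonalPoly lam n)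
  have h2 := congrArg (eval 1) (add_mul_ultra (lam + 1) n)
  simp only [eval_mul, eval_add, eval_sub, eval_neg, eval_natCast, eval_C, eval_X, eval_pow,
    eval_one, eval_ofNat] at h1 h2
  linear_combination h1 + 2 * (2 * lam + 1) * h2

theorem zonalPoly_eval_one_pos {lam : ℝ} (hlam : -(1 / 2) < lam) (n : ℕ) :
    0 < (zonalPoly lam n).eval 1 := by
  induction n generalizing lam with
  | zero => simp [zonalPoly_zero]
  | succ n ih =>
    have h := zonalPoly_succ_eval_one lam n
    have h1 := ih (lam := lam + 1) (by linarith)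
    have h2 : 0 < ((n : ℝ) + 1) * (n + 1 + 2 * lam) := by
      have : (0 : ℝ) ≤ n := Nat.cast_nonneg n
      apply mul_pos <;> linarith
    have h3 : 0 < 2 * (lam + 1) * (2 * lam + 1) := by apply mul_pos <;> linarith
    have h4 := mul_pos h3 h1
    rw [← h] at h4
    exact (pos_iff_pos_of_mul_pos h4).1 h2

theorem succ_mul_multichoose_succ (r : ℝ) (k : ℕ) :
    ((k : ℝ) + 1) * Ring.multichoose r (k + 1) = (r + k) * Ring.multichoose r k := by
  have h1 := Ring.factorial_nsmul_multichoose_eq_ascPochhammer r (k + 1)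
  have h0 := Ring.factorial_nsmul_multichoose_eq_ascPochhammer r k
  rw [ascPochhammer_smeval_eq_eval, ascPochhammer_succ_right] at h1
  rw [ascPochhammer_smeval_eq_eval] at h0
  simp only [eval_mul, eval_add, eval_X, eval_natCast, nsmul_eq_mul,
    Nat.factorial_succ] at h0 h1
  have : (k.factorial : ℝ) ≠ 0 := by positivity
  apply mul_left_cancel₀ this
  push_cast at h1
  linear_combination h1 - (r + k) * h0

theorem ultra_eval_one (mu : ℝ) (n : ℕ) :
    (ultra mu n).eval 1 = Ring.multichoose (2 * mu) n := by
  induction n with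
  | zero => simp [ultra_zero]
  | succ n ih =>
    have h1 := congrArg (eval 1) (one_sub_sq_mul_derivative_ultra mu n)
    simp only [eval_mul, eval_add, eval_sub, eval_natCast, eval_C, eval_X, eval_pow,
      eval_one, eval_ofNat] at h1
    have h2 := succ_mul_multichoose_succ (2 * mu) n
    have : ((n : ℝ) + 1) ≠ 0 := by positivity
    apply mul_left_cancel₀ this
    linear_combination h1 - h2 + (n + 2 * mu) * ih

end Ultraspherical

/-! ### Orthogonality and norms for the Gegenbauer weight -/

section Orthogonality

open Polynomial

theorem intervalIntegrable_weight {lam : ℝ} (hlam : -(1 / 2) < lam) :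
    IntervalIntegrable (weight lam) MeasureTheory.volume (-1) 1 := by
  have ha : -1 < lam - 1 / 2 := by linarith
  have hw : ∀ t ∈ Set.Icc (-1 : ℝ) 1,
      (1 + t) ^ (lam - 1 / 2) * (1 - t) ^ (lam - 1 / 2) = weight lam t := by
    intro t ht
    rw [weight, ← Real.mul_rpow (by linarith [ht.1]) (by linarith [ht.2])]
    ring_nf
  refine IntervalIntegrable.trans (b := 0) ?_ ?_
  · have h1 : IntervalIntegrable (fun t : ℝ => (1 + t) ^ (lam - 1 / 2)) MeasureTheory.volume
        (-1) 0 := by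
      have := (intervalIntegral.intervalIntegrable_rpow' (a := 0) (b := 1) ha).comp_add_left 1
      simpa using this
    refine (h1.mul_continuousOn (g := fun t => (1 - t) ^ (lam - 1 / 2)) ?_).congr ?_
    · refine ContinuousOn.rpow_const (by fun_prop) fun t ht => Or.inl ?_
      rw [Set.uIcc_of_le (by norm_num)] at ht
      linarith [ht.2]
    · intro t ht
      rw [Set.uIoc_of_le (by norm_num)] at ht
      exact hw t ⟨ht.1.le, by linarith [ht.2]⟩
  · have h1 : IntervalIntegrable (fun t : ℝ => (1 - t) ^ (lam - 1 / 2)) MeasureTheory.volume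
        0 1 := by
      have := (intervalIntegral.intervalIntegrable_rpow' (a := 1) (b := 0) ha).comp_sub_left 1
      simpa using this
    refine (h1.continuousOn_mul (g := fun t => (1 + t) ^ (lam - 1 / 2)) ?_).congr ?_
    · refine ContinuousOn.rpow_const (by fun_prop) fun t ht => Or.inl ?_
      rw [Set.uIcc_of_le (by norm_num)] at ht
      linarith [ht.1]
    · intro t ht
      rw [Set.uIoc_of_le (by norm_num)] at ht
      exact hw t ⟨by linarith [ht.1], ht.2⟩

theorem intervalIntegrable_eval_mul_weight {lam : ℝ} (hlam : -(1 / 2) < lam) (p : ℝ[X]) :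
    IntervalIntegrable (fun t => p.eval t * weight lam t) MeasureTheory.volume (-1) 1 :=
  (intervalIntegrable_weight hlam).continuousOn_mul p.continuous.continuousOn

theorem integral_weight_pos {lam : ℝ} (hlam : -(1 / 2) < lam) :
    0 < ∫ t in (-1 : ℝ)..1, weight lam t := by
  refine intervalIntegral.intervalIntegral_pos_of_pos_on (intervalIntegrable_weight hlam)
    (fun t ht => Real.rpow_pos_of_pos ?_ _) (by norm_num)
  nlinarith [ht.1, ht.2]

theorem weightConst_pos {lam : ℝ} (hlam : -(1 / 2) < lam) : 0 < weightConst lam :=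
  inv_pos.2 (integral_weight_pos hlam)

/-- The mean of `p` with respect to the probability density `c_λ w_λ` on `[-1, 1]`. -/
def mean (lam : ℝ) (p : ℝ[X]) : ℝ :=
  weightConst lam * ∫ t in (-1 : ℝ)..1, p.eval t * weight lam t

theorem mean_one {lam : ℝ} (hlam : -(1 / 2) < lam) : mean lam 1 = 1 := by
  simp only [mean, eval_one, one_mul, weightConst]
  exact inv_mul_cancel₀ (integral_weight_pos hlam).ne'

theorem mean_add {lam : ℝ} (hlam : -(1 / 2) < lam) (p q : ℝ[X]) :
    mean lam (p + q) = mean lam p + mean lam q := by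
  simp only [mean, eval_add, add_mul]
  rw [intervalIntegral.integral_add (intervalIntegrable_eval_mul_weight hlam p)
    (intervalIntegrable_eval_mul_weight hlam q), mul_add]

theorem mean_sub {lam : ℝ} (hlam : -(1 / 2) < lam) (p q : ℝ[X]) :
    mean lam (p - q) = mean lam p - mean lam q := by
  simp only [mean, eval_sub, sub_mul]
  rw [intervalIntegral.integral_sub (intervalIntegrable_eval_mul_weight hlam p)
    (intervalIntegrable_eval_mul_weight hlam q), mul_sub]

theorem mean_C_mul (lam a : ℝ) (p : ℝ[X]) : mean lam (C a * p) = a * mean lam p := by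
  simp only [mean, eval_mul, eval_C, mul_assoc, intervalIntegral.integral_const_mul]
  ring

/-- Integration by parts against `w_λ`: the boundary terms of `p w_{λ+1}` vanish since
`λ + 1/2 > 0`. -/
theorem mean_one_sub_sq_mul_derivative {lam : ℝ} (hlam : -(1 / 2) < lam) (p : ℝ[X]) :
    mean lam ((1 - X ^ 2) * derivative p) = (2 * lam + 1) * mean lam (X * p) := by
  have key : ∫ t in (-1 : ℝ)..1, ((1 - X ^ 2) * derivative p - C (2 * lam + 1) * (X * p)).eval t
      * weight lam t = 0 := by
    have h := intervalIntegral.integral_eq_sub_of_hasDerivAt_of_le (a := -1) (b := 1)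
      (f := fun t => p.eval t * (1 - t ^ 2) ^ (lam + 1 / 2))
      (f' := fun t => ((1 - X ^ 2) * derivative p - C (2 * lam + 1) * (X * p)).eval t
        * weight lam t) (by norm_num) ?_ ?_ (intervalIntegrable_eval_mul_weight hlam _)
    · rw [h]
      have h0 : lam + 1 / 2 ≠ 0 := by linarith
      norm_num [Real.zero_rpow h0]
    · refine p.continuous.continuousOn.mul (ContinuousOn.rpow_const (by fun_prop) fun t _ => ?_)
      right; linarith
    · intro t ht
      have hpos : 0 < 1 - t ^ 2 := by nlinarith [ht.1, ht.2]
      have h1 : HasDerivAt (fun t : ℝ => 1 - t ^ 2) (-(2 * t)) t := by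
        simpa using (hasDerivAt_pow 2 t).const_sub 1
      have h2 := (p.hasDerivAt t).mul (h1.rpow_const (p := lam + 1 / 2) (Or.inl hpos.ne'))
      refine h2.congr_deriv ?_
      have e1 : lam + 1 / 2 - 1 = lam - 1 / 2 := by ring
      have e2 : (1 - t ^ 2) ^ (lam + 1 / 2) = (1 - t ^ 2) ^ (lam - 1 / 2) * (1 - t ^ 2) := by
        rw [← Real.rpow_add_one hpos.ne']; ring_nf
      rw [e1, e2, weight]
      simp only [eval_sub, eval_mul, eval_one, eval_pow, eval_X, eval_C]
      ring
  have h := mean_sub hlam ((1 - X ^ 2) * derivative p) (C (2 * lam + 1) * (X * p))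
  rw [mean_C_mul, mean, key, mul_zero] at h
  linarith

theorem mean_one_sub_sq {lam : ℝ} (hlam : -(1 / 2) < lam) :
    (2 * lam + 2) * mean lam (1 - X ^ 2) = 2 * lam + 1 := by
  have h := mean_one_sub_sq_mul_derivative hlam X
  have h2 := mean_sub hlam 1 (X ^ 2)
  rw [mean_one hlam] at h2
  rw [derivative_X, mul_one, ← sq] at h
  linear_combination h + (2 * lam + 1) * h2

/-- `w_{λ+1} = (1 - t²) w_λ`, in terms of normalized means. -/
theorem mean_add_one_index {lam : ℝ} (hlam : -(1 / 2) < lam) (p : ℝ[X]) :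
    (2 * lam + 2) * mean lam ((1 - X ^ 2) * p) = (2 * lam + 1) * mean (lam + 1) p := by
  have hw : ∀ q : ℝ[X], ∫ t in (-1 : ℝ)..1, q.eval t * weight (lam + 1) t =
      ∫ t in (-1 : ℝ)..1, ((1 - X ^ 2) * q).eval t * weight lam t := by
    intro q
    refine intervalIntegral.integral_congr fun t ht => ?_
    rw [Set.uIcc_of_le (by norm_num)] at ht
    have h0 : 0 ≤ 1 - t ^ 2 := by nlinarith [ht.1, ht.2]
    have e : weight (lam + 1) t = weight lam t * (1 - t ^ 2) := by
      rw [weight, weight, ← Real.rpow_add_one' h0 (by linarith)]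
      ring_nf
    simp only [e, eval_mul, eval_sub, eval_one, eval_pow, eval_X]
    ring
  have h1 := mean_one (lam := lam + 1) (by linarith)
  have h2 := mean_one_sub_sq hlam
  simp only [mean, hw, mul_one] at h1 h2 ⊢
  have hc : (2 * lam + 2) * weightConst lam = (2 * lam + 1) * weightConst (lam + 1) := by
    linear_combination (-(2 * lam + 2) * weightConst lam) * h1 + weightConst (lam + 1) * h2
  rw [← mul_assoc, hc, mul_assoc]

/-- Integration by parts through the Rodrigues-type relation, which trades `Z_{n+1}^λ` for
`Z_n^{λ+1}`; orthogonality and norms follow by induction on `n`, for all `λ` at once. -/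
theorem mean_zonalPoly_mul {lam : ℝ} (hlam : -(1 / 2) < lam) (n : ℕ) (q : ℝ[X]) :
    ((n : ℝ) + 1) * (n + 1 + 2 * lam) * mean lam (zonalPoly lam (n + 1) * q) =
      (2 * lam + 1) * mean (lam + 1) (zonalPoly (lam + 1) n * derivative q) := by
  have hR := congrArg (fun p => mean lam (p * q)) (rodrigues_zonalPoly lam n)
  have hI := mean_one_sub_sq_mul_derivative hlam (ultra (lam + 1) n * q)
  have hS := mean_add_one_index hlam (ultra (lam + 1) n * derivative q)
  have hZ := congrArg (fun p => mean (lam + 1) (p * derivative q)) (add_mul_ultra (lam + 1) n)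
  set u := ultra (lam + 1) n
  have e1 : 2 * ((n : ℝ[X]) + 1 + C lam) * ((1 - X ^ 2) * derivative u
      - (2 * C lam + 1) * X * u) * q = C (2 * (n + 1 + lam)) * ((1 - X ^ 2) * derivative (u * q)
      - (1 - X ^ 2) * (u * derivative q) - C (2 * lam + 1) * (X * (u * q))) := by
    simp only [derivative_mul, C_mul, C_add, map_natCast, C_1, map_ofNat]
    ring
  have e2 : -(((n : ℝ[X]) + 1) * ((n : ℝ[X]) + 1 + 2 * C lam) * zonalPoly lam (n + 1)) * q =
      C (-((n + 1) * (n + 1 + 2 * lam))) * (zonalPoly lam (n + 1) * q) := by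
    simp only [C_mul, C_add, C_neg, map_natCast, C_1, map_ofNat]
    ring
  have e3 : ((n : ℝ[X]) + C (lam + 1)) * u * derivative q =
      C (n + (lam + 1)) * (u * derivative q) := by
    simp only [C_add, map_natCast]
    ring
  simp only [e1, e2, mean_C_mul, mean_sub hlam] at hR
  simp only [e3, mul_assoc (C (lam + 1)), mean_C_mul] at hZ
  have h0 : lam + 1 ≠ 0 := by linarith
  apply mul_left_cancel₀ h0
  linear_combination (lam + 1) * hR - 2 * (n + 1 + lam) * (lam + 1) * hI
    + (n + 1 + lam) * hS + (2 * lam + 1) * hZ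

/-- `Z_n^λ` is orthogonal to all polynomials of lower degree. -/
theorem mean_zonalPoly_mul_eq_zero {lam : ℝ} (hlam : -(1 / 2) < lam) {n : ℕ} {q : ℝ[X]}
    (hq : q.degree < n) : mean lam (zonalPoly lam n * q) = 0 := by
  induction n generalizing lam q with
  | zero =>
    have : q = 0 := by simpa using hq
    simp [this, mean]
  | succ n ih =>
    have h := mean_zonalPoly_mul hlam n q
    have hd : (derivative q).degree < n := by
      by_cases h0 : q = 0
      · subst h0; simp
      · by_cases h1 : derivative q = 0
        · rw [h1]; simp
        have h2 := degree_derivative_lt h0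
        rw [degree_eq_natDegree h1] at h2 ⊢
        rw [degree_eq_natDegree h0] at h2 hq
        norm_cast at *
        omega
    rw [ih (by linarith) hd, mul_zero] at h
    have hp : ((n : ℝ) + 1) * (n + 1 + 2 * lam) ≠ 0 := by
      have : (0 : ℝ) ≤ n := Nat.cast_nonneg n
      apply mul_ne_zero <;> linarith
    exact (mul_eq_zero.1 h).resolve_left hp

/-- The squared norm of `Z_n^λ` is `Z_n^λ(1)`: it reproduces its own value at `1`. -/
theorem mean_zonalPoly_mul_self {lam : ℝ} (hlam : -(1 / 2) < lam) (n : ℕ) :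
    mean lam (zonalPoly lam n * zonalPoly lam n) = (zonalPoly lam n).eval 1 := by
  induction n generalizing lam with
  | zero => simp [zonalPoly_zero, mean_one hlam]
  | succ n ih =>
    have h := mean_zonalPoly_mul hlam n (zonalPoly lam (n + 1))
    have h1 := zonalPoly_succ_eval_one lam n
    have h2 := ih (lam := lam + 1) (by linarith)
    have e : zonalPoly (lam + 1) n * derivative (zonalPoly lam (n + 1)) =
        C (2 * (lam + 1)) * (zonalPoly (lam + 1) n * zonalPoly (lam + 1) n) := by
      have := add_mul_ultra (lam + 1) n
      rw [derivative_zonalPoly]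
      simp only [C_mul, C_add, C_1, map_ofNat] at *
      linear_combination 2 * zonalPoly (lam + 1) n * this
    rw [e, mean_C_mul, h2] at h
    have hp : ((n : ℝ) + 1) * (n + 1 + 2 * lam) ≠ 0 := by
      have : (0 : ℝ) ≤ n := Nat.cast_nonneg n
      apply mul_ne_zero <;> linarith
    apply mul_left_cancel₀ hp
    linear_combination h - h1

theorem mean_zonalPoly_mul_zonalPoly {lam : ℝ} (hlam : -(1 / 2) < lam) (n m : ℕ) :
    mean lam (zonalPoly lam n * zonalPoly lam m) =
      if n = m then (zonalPoly lam n).eval 1 else 0 := by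
  have hd : ∀ k, (zonalPoly lam k).degree ≤ k := fun k =>
    natDegree_le_iff_degree_le.1 (natDegree_zonalPoly_le lam k)
  split_ifs with h
  · rw [← h, mean_zonalPoly_mul_self hlam]
  · rcases lt_or_gt_of_ne h with h | h
    · rw [mul_comm]
      exact mean_zonalPoly_mul_eq_zero hlam ((hd n).trans_lt (by exact_mod_cast h))
    · exact mean_zonalPoly_mul_eq_zero hlam ((hd m).trans_lt (by exact_mod_cast h))

/-- A polynomial of degree at most `n` is a combination of `Z_0^λ, …, Z_n^λ`. -/
theorem exists_sum_zonalPoly {lam : ℝ} (hlam : -1 < lam) {n : ℕ} {p : ℝ[X]}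
    (hp : p.natDegree ≤ n) :
    ∃ a : ℕ → ℝ, p = ∑ k ∈ Finset.range (n + 1), C (a k) * zonalPoly lam k := by
  induction n generalizing p with
  | zero =>
    refine ⟨fun _ => p.coeff 0, ?_⟩
    rw [eq_C_of_natDegree_le_zero hp]
    simp [zonalPoly_zero]
  | succ n ih =>
    set b := p.coeff (n + 1) / (zonalPoly lam (n + 1)).coeff (n + 1) with hb
    have hc := (coeff_zonalPoly_pos hlam (n + 1)).ne'
    have hr : (p - C b * zonalPoly lam (n + 1)).natDegree ≤ n := by
      rw [natDegree_le_iff_coeff_eq_zero]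
      intro N hN
      rcases (Nat.succ_le_of_lt hN).eq_or_lt with h | h
      · rw [← h, coeff_sub, coeff_C_mul, hb, Nat.succ_eq_add_one, div_mul_cancel₀ _ hc, sub_self]
      · rw [coeff_sub, coeff_C_mul, coeff_eq_zero_of_natDegree_lt (by omega),
          coeff_eq_zero_of_natDegree_lt
            (by have := natDegree_zonalPoly_le lam (n + 1); omega), mul_zero, sub_zero]
    obtain ⟨a, ha⟩ := ih hr
    refine ⟨fun k => if k = n + 1 then b else a k, ?_⟩
    simp only
    rw [Finset.sum_range_succ, if_pos rfl, ← sub_eq_iff_eq_add, ha]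
    refine Finset.sum_congr rfl fun k hk => ?_
    rw [if_neg (by have := Finset.mem_range.1 hk; omega)]

/-- A polynomial of degree at most `n` orthogonal to all lower degrees is a multiple of `Z_n^λ`. -/
theorem eq_C_mul_zonalPoly {lam : ℝ} (hlam : -(1 / 2) < lam) {n : ℕ} {p : ℝ[X]}
    (hp : p.natDegree ≤ n)
    (horth : ∀ q : ℝ[X], q.degree < n → mean lam (p * q) = 0) :
    ∃ a : ℝ, p = C a * zonalPoly lam n := by
  obtain ⟨a, ha⟩ := exists_sum_zonalPoly (lam := lam) (by linarith) hp
  refine ⟨a n, ?_⟩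
  have h0 : ∀ s : Finset ℕ, ∀ q, mean lam ((∑ k ∈ s, C (a k) * zonalPoly lam k) * q) =
      ∑ k ∈ s, a k * mean lam (zonalPoly lam k * q) := by
    intro s q
    induction s using Finset.induction_on with
    | empty => simp [mean]
    | insert k s hk ih =>
      rw [Finset.sum_insert hk, Finset.sum_insert hk, add_mul, mean_add hlam, ih, mul_assoc,
        mean_C_mul]
  have hz : ∀ k < n, a k = 0 := by
    intro k hk
    have h := horth (zonalPoly lam k) ((natDegree_le_iff_degree_le.1
      (natDegree_zonalPoly_le lam k)).trans_lt (by exact_mod_cast hk))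
    rw [ha, h0] at h
    simp only [mean_zonalPoly_mul_zonalPoly hlam, mul_ite, mul_zero] at h
    rw [Finset.sum_ite_eq' , if_pos (Finset.mem_range.2 (by omega))] at h
    exact (mul_eq_zero.1 h).resolve_right (zonalPoly_eval_one_pos hlam k).ne'
  rw [ha, Finset.sum_range_succ, Finset.sum_eq_zero, zero_add]
  intro k hk
  rw [hz k (Finset.mem_range.1 hk), C_0, zero_mul]

theorem isGegenbauer_ultra {lam : ℝ} (hlam : 0 < lam) (n : ℕ) :
    IsGegenbauer lam n (ultra lam n) where
  degree_eq := by
    have hc := (coeff_ultra_pos hlam n).ne'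
    have hn : (ultra lam n).natDegree = n :=
      natDegree_eq_of_le_of_coeff_ne_zero (natDegree_ultra_le lam n) hc
    rw [degree_eq_natDegree (fun h => hc (by rw [h, coeff_zero])), hn]
  orthogonal q hq := by
    have hl : -(1 / 2) < lam := by linarith
    have h := mean_zonalPoly_mul_eq_zero hl hq
    have h1 := congrArg (fun p => mean lam (p * q)) (add_mul_ultra lam n)
    have e : ((n : ℝ[X]) + C lam) * ultra lam n * q = C (n + lam) * (ultra lam n * q) := by
      simp only [C_add, map_natCast]
      ring
    simp only [e, mul_assoc (C lam), mean_C_mul, h, mul_zero] at h1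
    have h2 := (mul_eq_zero.1 h1).resolve_left (by positivity)
    rw [mean] at h2
    have h3 := (mul_eq_zero.1 h2).resolve_left (weightConst_pos hl).ne'
    simpa only [eval_mul] using h3
  eval_one := by
    rw [ultra_eval_one, Ring.multichoose_eq, add_comm (2 * lam)]

/-- `IsGegenbauer` determines the polynomial: it is a multiple of `Z_n^λ`, and `Z_n^λ(1) ≠ 0`. -/
theorem gegenbauer_eq_ultra {lam : ℝ} (hlam : 0 < lam) (n : ℕ) :
    gegenbauer lam n = ultra lam n := by
  have hl : -(1 / 2) < lam := by linarith
  have huniq : ∀ p, IsGegenbauer lam n p → ∃ a : ℝ, p = C a * zonalPoly lam n := by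
    intro p hp
    refine eq_C_mul_zonalPoly hl (natDegree_le_of_degree_le hp.degree_eq.le) fun q hq => ?_
    have := hp.orthogonal q hq
    simp only [mean, eval_mul, this, mul_zero]
  have hU := isGegenbauer_ultra hlam n
  have hG : IsGegenbauer lam n (gegenbauer lam n) := Classical.epsilon_spec ⟨_, hU⟩
  obtain ⟨a, ha⟩ := huniq _ hG
  obtain ⟨b, hb⟩ := huniq _ hU
  have h := hG.eval_one.trans hU.eval_one.symm
  rw [ha, hb, eval_mul, eval_mul, eval_C, eval_C] at h
  rw [ha, hb, mul_right_cancel₀ (zonalPoly_eval_one_pos hl n).ne' h]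

theorem zonal_eq_eval_zonalPoly {lam : ℝ} (hlam : 0 < lam) (n : ℕ) (t : ℝ) :
    zonal lam n t = (zonalPoly lam n).eval t := by
  have h := congrArg (eval t) (add_mul_ultra lam n)
  simp only [eval_mul, eval_add, eval_natCast, eval_C] at h
  rw [zonal, gegenbauer_eq_ultra hlam, div_mul_eq_mul_div, h]
  field_simp

end Orthogonality

/-! ### The product weight on the cube -/

section Cube

open MeasureTheory

variable {d : ℕ}

/-- The product `∏ p_i(x_i)` of polynomials in separate variables. -/
def tensorPoly (p : Fin d → Polynomial ℝ) : MvPolynomial (Fin d) ℝ :=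
  ∏ i, Polynomial.aeval (MvPolynomial.X i) (p i)

theorem eval_tensorPoly (p : Fin d → Polynomial ℝ) (x : Fin d → ℝ) :
    MvPolynomial.eval x (tensorPoly p) = ∏ i, (p i).eval (x i) := by
  simp only [tensorPoly, map_prod]
  refine Finset.prod_congr rfl fun i _ => ?_
  rw [Polynomial.aeval_def, Polynomial.hom_eval₂, MvPolynomial.eval_X,
    show (MvPolynomial.eval x).comp (algebraMap ℝ (MvPolynomial (Fin d) ℝ)) = RingHom.id ℝ by
      ext; simp, Polynomial.eval₂_id]

theorem volume_restrict_cube :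
    (volume : Measure (Fin d → ℝ)).restrict (Set.Icc (-1) 1) =
      Measure.pi fun _ => (volume : Measure ℝ).restrict (Set.Icc (-1) 1) := by
  rw [volume_pi, ← Measure.restrict_pi_pi, ← Set.pi_univ_Icc]
  rfl

theorem integrableOn_prodWeight {lam : Fin d → ℝ} (hlam : ∀ i, -(1 / 2 : ℝ) < lam i) :
    IntegrableOn (prodWeight lam) (Set.Icc (-1) 1) := by
  rw [IntegrableOn, volume_restrict_cube]
  refine Integrable.const_mul (Integrable.fintype_prod fun i => ?_) _
  have h := intervalIntegrable_weight (hlam i)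
  rwa [intervalIntegrable_iff_integrableOn_Icc_of_le (by norm_num)] at h

theorem integrableOn_eval_mul_eval_mul_prodWeight {lam : Fin d → ℝ}
    (hlam : ∀ i, -(1 / 2 : ℝ) < lam i) (p q : MvPolynomial (Fin d) ℝ) :
    IntegrableOn (fun x => MvPolynomial.eval x p * MvPolynomial.eval x q * prodWeight lam x)
      (Set.Icc (-1) 1) :=
  (integrableOn_prodWeight hlam).continuousOn_mul
    (p.continuous_eval.mul q.continuous_eval).continuousOn isCompact_Icc

/-- `p ↦ ⟨p, q⟩_W` as a linear map. -/
def polyInnerLeft {lam : Fin d → ℝ} (hlam : ∀ i, -(1 / 2 : ℝ) < lam i)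
    (q : MvPolynomial (Fin d) ℝ) : MvPolynomial (Fin d) ℝ →ₗ[ℝ] ℝ where
  toFun p := polyInner (prodWeight lam) p q
  map_add' p p' := by
    simp only [polyInner, map_add, add_mul]
    exact integral_add (integrableOn_eval_mul_eval_mul_prodWeight hlam p q)
      (integrableOn_eval_mul_eval_mul_prodWeight hlam p' q)
  map_smul' a p := by
    simp only [polyInner, MvPolynomial.smul_eval, mul_assoc, RingHom.id_apply, smul_eq_mul]
    exact integral_const_mul _ _

theorem polyInnerLeft_apply {lam : Fin d → ℝ} (hlam : ∀ i, -(1 / 2 : ℝ) < lam i)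
    (p q : MvPolynomial (Fin d) ℝ) :
    polyInnerLeft hlam q p = polyInner (prodWeight lam) p q := rfl

theorem polyInner_comm (W : (Fin d → ℝ) → ℝ) (p q : MvPolynomial (Fin d) ℝ) :
    polyInner W p q = polyInner W q p := by
  simp only [polyInner, mul_comm (MvPolynomial.eval _ p)]

theorem polyInner_smul_smul (W : (Fin d → ℝ) → ℝ) (a b : ℝ) (p q : MvPolynomial (Fin d) ℝ) :
    polyInner W (a • p) (b • q) = a * b * polyInner W p q := by
  simp only [polyInner, MvPolynomial.smul_eval]
  rw [← integral_const_mul]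
  congr 1 with x
  ring

theorem polyInner_tensorPoly (lam : Fin d → ℝ) (p q : Fin d → Polynomial ℝ) :
    polyInner (prodWeight lam) (tensorPoly p) (tensorPoly q) =
      ∏ i, mean (lam i) (p i * q i) := by
  simp only [polyInner, eval_tensorPoly, prodWeight, mean]
  rw [volume_restrict_cube, Finset.prod_mul_distrib]
  have h : ∀ x : Fin d → ℝ, (∏ i, (p i).eval (x i)) * (∏ i, (q i).eval (x i)) *
      ((∏ i, weightConst (lam i)) * ∏ i, weight (lam i) (x i)) =
      (∏ i, weightConst (lam i)) * ∏ i, ((p i * q i).eval (x i) * weight (lam i) (x i)) := by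
    intro x
    simp only [Polynomial.eval_mul, Finset.prod_mul_distrib]
    ring
  simp only [h]
  rw [integral_const_mul, integral_fintype_prod_eq_prod
    (f := fun i t => (p i * q i).eval t * weight (lam i) t)]
  congr 1
  refine Finset.prod_congr rfl fun i _ => ?_
  rw [intervalIntegral.integral_of_le (by norm_num), integral_Icc_eq_integral_Ioc]

theorem totalDegree_tensorPoly_le (p : Fin d → Polynomial ℝ) :
    (tensorPoly p).totalDegree ≤ ∑ i, (p i).natDegree := by
  refine (MvPolynomial.totalDegree_finsetProd _ _).trans (Finset.sum_le_sum fun i _ => ?_)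
  rw [Polynomial.aeval_eq_sum_range]
  refine MvPolynomial.totalDegree_finsetSum_le fun k hk => ?_
  refine (MvPolynomial.totalDegree_smul_le _ _).trans ?_
  rw [MvPolynomial.totalDegree_X_pow]
  exact Nat.lt_succ_iff.1 (Finset.mem_range.1 hk)

/-- The orthogonal (not normalized) basis `∏ Z_{α_i}^{λ_i}(x_i)`. -/
def tensorZonal (lam : Fin d → ℝ) (α : Fin d →₀ ℕ) : MvPolynomial (Fin d) ℝ :=
  tensorPoly fun i => zonalPoly (lam i) (α i)

theorem eval_tensorZonal (lam : Fin d → ℝ) (α : Fin d →₀ ℕ) (x : Fin d → ℝ) :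
    MvPolynomial.eval x (tensorZonal lam α) = ∏ i, (zonalPoly (lam i) (α i)).eval (x i) :=
  eval_tensorPoly _ _

theorem eval_one_tensorZonal_pos {lam : Fin d → ℝ} (hlam : ∀ i, -(1 / 2 : ℝ) < lam i)
    (α : Fin d →₀ ℕ) : 0 < MvPolynomial.eval 1 (tensorZonal lam α) := by
  rw [eval_tensorZonal]
  exact Finset.prod_pos fun i _ => zonalPoly_eval_one_pos (hlam i) _

theorem polyInner_tensorZonal {lam : Fin d → ℝ} (hlam : ∀ i, -(1 / 2 : ℝ) < lam i)
    (α β : Fin d →₀ ℕ) :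
    polyInner (prodWeight lam) (tensorZonal lam α) (tensorZonal lam β) =
      if α = β then MvPolynomial.eval 1 (tensorZonal lam α) else 0 := by
  rw [tensorZonal, tensorZonal, polyInner_tensorPoly, ← tensorZonal, eval_tensorZonal]
  simp only [mean_zonalPoly_mul_zonalPoly (hlam _)]
  split_ifs with h
  · subst h; simp
  · obtain ⟨i, hi⟩ : ∃ i, α i ≠ β i := by
      by_contra hc
      push Not at hc
      exact h (Finsupp.ext hc)
    exact Finset.prod_eq_zero (Finset.mem_univ i) (if_neg hi)

theorem totalDegree_tensorZonal_le {lam : Fin d → ℝ} (α : Fin d →₀ ℕ) :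
    (tensorZonal lam α).totalDegree ≤ ∑ i, α i :=
  (totalDegree_tensorPoly_le _).trans
    (Finset.sum_le_sum fun i _ => natDegree_zonalPoly_le (lam i) (α i))

theorem monomial_mem_span_tensorZonal {lam : Fin d → ℝ} (hlam : ∀ i, -(1 / 2 : ℝ) < lam i)
    (s : Fin d →₀ ℕ) (c : ℝ) :
    MvPolynomial.monomial s c ∈ Submodule.span ℝ
      (tensorZonal lam '' {α | ∑ i, α i ≤ ∑ i, s i}) := by
  have hX : ∀ i, ∃ a : ℕ → ℝ, (MvPolynomial.X i ^ s i : MvPolynomial (Fin d) ℝ) =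
      ∑ k ∈ Finset.range (s i + 1),
        a k • Polynomial.aeval (MvPolynomial.X i) (zonalPoly (lam i) k) := by
    intro i
    obtain ⟨a, ha⟩ := exists_sum_zonalPoly (lam := lam i) (n := s i) (p := Polynomial.X ^ s i)
      (by linarith [hlam i]) (by simp)
    refine ⟨a, ?_⟩
    have h := congrArg (Polynomial.aeval (MvPolynomial.X i : MvPolynomial (Fin d) ℝ)) ha
    simpa only [map_pow, Polynomial.aeval_X, map_sum, ← Polynomial.smul_eq_C_mul,
      map_smul] using h
  choose a ha using hX
  rw [MvPolynomial.monomial_eq, Finsupp.prod_fintype _ _ (by simp), ← MvPolynomial.smul_eq_C_mul]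
  refine Submodule.smul_mem _ _ ?_
  simp only [ha, Finset.prod_univ_sum]
  refine Submodule.sum_mem _ fun f hf => ?_
  rw [Fintype.mem_piFinset] at hf
  rw [show (∏ i, a i (f i) • Polynomial.aeval (MvPolynomial.X i) (zonalPoly (lam i) (f i)) :
      MvPolynomial (Fin d) ℝ) = (∏ i, a i (f i)) •
      tensorZonal lam (Finsupp.equivFunOnFinite.symm f) by
    rw [tensorZonal, tensorPoly, Finset.prod_smul]; rfl]
  refine Submodule.smul_mem _ _ (Submodule.subset_span ⟨_, ?_, rfl⟩)
  exact Finset.sum_le_sum fun i _ => Nat.lt_succ_iff.1 (Finset.mem_range.1 (hf i))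

theorem mem_span_tensorZonal {lam : Fin d → ℝ} (hlam : ∀ i, -(1 / 2 : ℝ) < lam i) {n : ℕ}
    {p : MvPolynomial (Fin d) ℝ} (hp : p.totalDegree ≤ n) :
    p ∈ Submodule.span ℝ (tensorZonal lam '' {α | ∑ i, α i ≤ n}) := by
  rw [p.as_sum]
  refine Submodule.sum_mem _ fun s hs => ?_
  refine Submodule.span_mono (Set.image_mono fun α hα => ?_)
    (monomial_mem_span_tensorZonal hlam s _)
  have h := (MvPolynomial.le_totalDegree hs).trans hp
  rw [Finsupp.sum_fintype _ _ (by simp)] at h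
  exact le_trans hα h

theorem tensorZonal_mem_orthoSpace {lam : Fin d → ℝ} (hlam : ∀ i, -(1 / 2 : ℝ) < lam i)
    (α : Fin d →₀ ℕ) :
    tensorZonal lam α ∈ orthoSpace (prodWeight lam) (∑ i, α i) := by
  refine ⟨totalDegree_tensorZonal_le α, fun q hq => ?_⟩
  have hq' := mem_span_tensorZonal hlam (Nat.le_sub_one_of_lt hq)
  have hpos : 0 < ∑ i, α i := by omega
  rw [polyInner_comm, ← polyInnerLeft_apply hlam]
  clear hq
  induction hq' using Submodule.span_induction with
  | mem q h =>
    obtain ⟨β, hβ, rfl⟩ := h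
    rw [polyInnerLeft_apply, polyInner_tensorZonal hlam, if_neg]
    rintro rfl
    have : ∑ i, β i ≤ ∑ i, β i - 1 := hβ
    omega
  | zero => exact map_zero _
  | add p q _ _ hp hq => rw [map_add, hp, hq, add_zero]
  | smul a p _ hp => rw [map_smul, hp, smul_zero]

/-- `V_n^d(W_λ)` is spanned by the products of degree exactly `n`. -/
theorem mem_span_of_mem_orthoSpace {lam : Fin d → ℝ} (hlam : ∀ i, -(1 / 2 : ℝ) < lam i) {n : ℕ}
    {p : MvPolynomial (Fin d) ℝ} (hp : p ∈ orthoSpace (prodWeight lam) n) :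
    p ∈ Submodule.span ℝ (tensorZonal lam '' {α | ∑ i, α i = n}) := by
  obtain ⟨l, hl, rfl⟩ :=
    (Finsupp.mem_span_image_iff_linearCombination ℝ).1 (mem_span_tensorZonal hlam hp.1)
  refine (Finsupp.mem_span_image_iff_linearCombination ℝ).2 ⟨l, fun β hβ => ?_, rfl⟩
  have hle : ∑ i, β i ≤ n := hl hβ
  by_contra hne
  have hlt : ∑ i, β i < n := lt_of_le_of_ne hle hne
  have h := hp.2 (tensorZonal lam β) ((totalDegree_tensorZonal_le β).trans_lt hlt)
  rw [← polyInnerLeft_apply hlam, Finsupp.linearCombination_apply, map_finsuppSum] at h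
  simp only [map_smul, polyInnerLeft_apply, polyInner_tensorZonal hlam, smul_eq_mul,
    mul_ite, mul_zero] at h
  rw [Finsupp.sum, Finset.sum_ite_eq', if_pos (Finset.mem_coe.1 hβ)] at h
  exact (mul_eq_zero.1 h).elim (Finsupp.mem_support_iff.1 hβ)
    (eval_one_tensorZonal_pos hlam β).ne'

theorem card_finsuppAntidiag_univ_fin (n : ℕ) :
    Fintype.card (Finset.finsuppAntidiag (Finset.univ : Finset (Fin d)) n) =
      (n + d - 1).choose n := by
  rw [Fintype.card_coe, Finset.card_finsuppAntidiag_nat_eq_choose, Finset.card_fin, add_comm]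

/-- The normalized products form an orthonormal basis of `V_n^d(W_λ)`. -/
theorem exists_isOrthoBasis {lam : Fin d → ℝ} (hlam : ∀ i, -(1 / 2 : ℝ) < lam i) (n : ℕ) :
    ∃ P, IsOrthoBasis (prodWeight lam) n P := by
  let e := Fintype.equivFinOfCardEq (card_finsuppAntidiag_univ_fin (d := d) n)
  let N : (Fin d →₀ ℕ) → ℝ := fun α => Real.sqrt (MvPolynomial.eval 1 (tensorZonal lam α))
  have hN : ∀ α, N α ≠ 0 := fun α => (Real.sqrt_pos.2 (eval_one_tensorZonal_pos hlam α)).ne'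
  have he : ∀ j, ∑ i, (e.symm j).1 i = n := fun j =>
    (Finset.mem_finsuppAntidiag.1 (e.symm j).2).1
  -- The squared norm of a product is its value at `1`.
  refine ⟨fun j => (N (e.symm j))⁻¹ • tensorZonal lam (e.symm j), ?_, ?_, ?_⟩
  · intro j
    have h := tensorZonal_mem_orthoSpace hlam (e.symm j).1
    rw [he] at h
    refine ⟨(MvPolynomial.totalDegree_smul_le _ _).trans h.1, fun q hq => ?_⟩
    rw [← polyInnerLeft_apply hlam, map_smul, polyInnerLeft_apply, h.2 q hq, smul_zero]
  · intro j k
    rw [polyInner_smul_smul, polyInner_tensorZonal hlam]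
    by_cases h : j = k
    · subst h
      have := Real.mul_self_sqrt (eval_one_tensorZonal_pos hlam (e.symm j).1).le
      rw [if_pos rfl, if_pos rfl, ← this, ← mul_inv]
      exact inv_mul_cancel₀ (mul_ne_zero (hN _) (hN _))
    · rw [if_neg h, if_neg (fun h' => h (e.symm.injective (Subtype.ext h'))), mul_zero]
  · intro p hp
    refine (Submodule.span_le.2 ?_) (mem_span_of_mem_orthoSpace hlam hp)
    rintro _ ⟨α, hα, rfl⟩
    have hα' : α ∈ Finset.finsuppAntidiag (Finset.univ : Finset (Fin d)) n :=
      Finset.mem_finsuppAntidiag.2 ⟨hα, Finset.subset_univ _⟩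
    have h : tensorZonal lam α = N α • ((N α)⁻¹ • tensorZonal lam α) := by
      rw [smul_smul, mul_inv_cancel₀ (hN α), one_smul]
    rw [h]
    refine Submodule.smul_mem _ _ (Submodule.subset_span ⟨e ⟨α, hα'⟩, ?_⟩)
    simp

/-- The reproducing kernel of the product weight at the corner `1` is the sum of the products of
the one-variable kernels. Both sides, as elements of `V_n^d(W_λ)`, represent evaluation at `1`. -/
theorem reproKernel_prodWeight_one {lam : Fin d → ℝ} (hlam : ∀ i, -(1 / 2 : ℝ) < lam i) (n : ℕ)
    (x : Fin d → ℝ) :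
    reproKernel (prodWeight lam) n x 1 =
      ∑ α ∈ Finset.finsuppAntidiag (Finset.univ : Finset (Fin d)) n,
        ∏ i, (zonalPoly (lam i) (α i)).eval (x i) := by
  have hP : IsOrthoBasis (prodWeight lam) n (orthoBasis (prodWeight lam) n) :=
    Classical.epsilon_spec (exists_isOrthoBasis hlam n)
  set P := orthoBasis (prodWeight lam) n with hPdef
  set Q : MvPolynomial (Fin d) ℝ :=
    ∑ α ∈ Finset.finsuppAntidiag (Finset.univ : Finset (Fin d)) n, tensorZonal lam α with hQ
  have hQeval : ∀ p ∈ orthoSpace (prodWeight lam) n,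
      polyInner (prodWeight lam) Q p = MvPolynomial.eval 1 p := by
    intro p hp
    rw [polyInner_comm, ← polyInnerLeft_apply hlam]
    have hp' := mem_span_of_mem_orthoSpace hlam hp
    clear hp
    induction hp' using Submodule.span_induction with
    | mem q h =>
      obtain ⟨β, hβ, rfl⟩ := h
      rw [polyInnerLeft_apply, polyInner_comm, ← polyInnerLeft_apply hlam, hQ, map_sum]
      simp only [polyInnerLeft_apply, polyInner_tensorZonal hlam]
      rw [Finset.sum_ite_eq', if_pos]
      exact Finset.mem_finsuppAntidiag.2 ⟨hβ, Finset.subset_univ _⟩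
    | zero => simp
    | add p q _ _ hp hq => rw [map_add, map_add, hp, hq]
    | smul a p _ hp => rw [map_smul, hp, MvPolynomial.smul_eval, smul_eq_mul]
  have hQspan : Q ∈ Submodule.span ℝ (Set.range P) := by
    refine Submodule.sum_mem _ fun α hα => hP.spans _ ?_
    have h := tensorZonal_mem_orthoSpace hlam α
    rwa [(Finset.mem_finsuppAntidiag.1 hα).1] at h
  obtain ⟨c, hc⟩ := (Submodule.mem_span_range_iff_exists_fun ℝ).1 hQspan
  have hcj : ∀ j, c j = MvPolynomial.eval 1 (P j) := by
    intro j
    rw [← hQeval _ (hP.mem j), ← hc, ← polyInnerLeft_apply hlam, map_sum]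
    simp [polyInnerLeft_apply, hP.orthonormal]
  have hx := congrArg (MvPolynomial.eval x) hc
  simp only [map_sum, MvPolynomial.smul_eval, hQ, eval_tensorZonal, hcj] at hx
  rw [← hx, reproKernel, ← hPdef]
  exact Finset.sum_congr rfl fun j _ => mul_comm _ _

end Cube

/-! ### Generating functions -/

section GeneratingFunctions

open PowerSeries

/-- The series `2 t r - r²` in `r`, so that `1 - 2 r t + r² = 1 - shiftSeries t`. -/
def shiftSeries (t : ℝ) : ℝ⟦X⟧ := C (2 * t) * X - X ^ 2

theorem coeff_shiftSeries_pow_eq_zero (t : ℝ) {n k : ℕ} (h : n < k) :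
    coeff n (shiftSeries t ^ k) = 0 := by
  have hd : (X : ℝ⟦X⟧) ^ k ∣ shiftSeries t ^ k :=
    pow_dvd_pow_of_dvd ⟨C (2 * t) - X, by rw [shiftSeries]; ring⟩ k
  exact X_pow_dvd_iff.1 hd n h

/-- The truncated binomial series `∑ binom(μ + k - 1, k) s^k` of `(1 - s)^(-μ)` satisfies the
differential equation of the full series up to the last term. -/
theorem truncated_binomial_ode (mu t : ℝ) (N : ℕ) :
    (1 - shiftSeries t) * derivative ℝ
        (∑ k ∈ Finset.range (N + 1), C (Ring.multichoose mu k) * shiftSeries t ^ k) =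
      (C (2 * t) - 2 * X) * (C mu * ∑ k ∈ Finset.range (N + 1),
          C (Ring.multichoose mu k) * shiftSeries t ^ k
        - C ((N + mu) * Ring.multichoose mu N) * shiftSeries t ^ N) := by
  have hd : derivative ℝ (shiftSeries t) = C (2 * t) - 2 * X := by
    rw [shiftSeries, map_sub, Derivation.leibniz, Derivation.leibniz_pow, derivative_X,
      derivative_C]
    simp
  rw [← hd]
  induction N with
  | zero => simp
  | succ N ih =>
    have hm := congrArg (C (R := ℝ)) (succ_mul_multichoose_succ mu N)
    rw [Finset.sum_range_succ, map_add, mul_add, ih, Derivation.leibniz, Derivation.leibniz_pow,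
      derivative_C]
    simp only [smul_eq_mul, nsmul_eq_mul, mul_zero, add_zero, map_mul, map_add, map_natCast,
      map_one, Nat.cast_succ, Nat.add_sub_cancel] at hm ⊢
    linear_combination (derivative ℝ (shiftSeries t) * shiftSeries t ^ N) * hm

/-- The generating function `∑ C_n^μ(t) r^n = (1 - 2 r t + r²)^(-μ)`, coefficient by coefficient:
only the powers `(2 t r - r²)^k` with `k ≤ n` contribute. -/
theorem ultra_eval_eq_sum (mu t : ℝ) {n N : ℕ} (hn : n ≤ N) :
    (ultra mu n).eval t =
      ∑ k ∈ Finset.range (N + 1), Ring.multichoose mu k * coeff n (shiftSeries t ^ k) := by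
  set S : ℝ⟦X⟧ := ∑ k ∈ Finset.range (N + 1), C (Ring.multichoose mu k) * shiftSeries t ^ k
    with hS
  have hcoeff : ∀ m, coeff m S =
      ∑ k ∈ Finset.range (N + 1), Ring.multichoose mu k * coeff m (shiftSeries t ^ k) := by
    intro m
    simp [hS, coeff_C_mul]
  rw [← hcoeff]
  have h0 : coeff 0 S = 1 := by
    rw [hcoeff, Finset.sum_range_succ', Finset.sum_eq_zero, zero_add]
    · simp
    · intro k _
      rw [coeff_shiftSeries_pow_eq_zero t (Nat.succ_pos k), mul_zero]
  have hode := truncated_binomial_ode mu t N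
  rw [← hS] at hode
  have e1 : ∀ F : ℝ⟦X⟧, (1 - shiftSeries t) * F = F - C (2 * t) * (X * F) + X * (X * F) := by
    intro F; rw [shiftSeries]; ring
  have e2 : ∀ F : ℝ⟦X⟧, (C (2 * t) - 2 * X) * F = C (2 * t) * F - C 2 * (X * F) := by
    intro F; rw [map_ofNat]; ring
  rw [e1, e2] at hode
  induction n using Nat.strong_induction_on with
  | _ n ih =>
    match n with
    | 0 => rw [h0, ultra_zero, Polynomial.eval_one]
    | 1 =>
      have h := congrArg (coeff 0) hode
      simp only [map_add, map_sub, coeff_C_mul, coeff_zero_X_mul, coeff_derivative,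
        coeff_shiftSeries_pow_eq_zero t (show 0 < N by omega), h0] at h
      rw [ultra_one]
      simp only [Polynomial.eval_mul, Polynomial.eval_C, Polynomial.eval_X]
      norm_num at h
      linarith
    | n + 2 =>
      have h := congrArg (coeff (n + 1)) hode
      have i0 := ih n (by omega) (by omega)
      have i1 := ih (n + 1) (by omega) (by omega)
      have hrec := congrArg (Polynomial.eval t) (ultra_rec mu n)
      simp only [Polynomial.eval_mul, Polynomial.eval_add, Polynomial.eval_sub,
        Polynomial.eval_natCast, Polynomial.eval_C, Polynomial.eval_X, Polynomial.eval_one,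
        Polynomial.eval_ofNat] at hrec
      have e3 : coeff (n + 1) (X * (X * derivative ℝ S)) = n * coeff n S := by
        rw [coeff_succ_X_mul]
        cases n with
        | zero => simp
        | succ n => rw [coeff_succ_X_mul, coeff_derivative]; push_cast; ring
      simp only [map_add, map_sub, e3, coeff_C_mul, coeff_succ_X_mul, coeff_derivative,
        coeff_shiftSeries_pow_eq_zero t (show n + 1 < N by omega),
        coeff_shiftSeries_pow_eq_zero t (show n < N by omega)] at h
      have hn2 : (n : ℝ) + 2 ≠ 0 := by positivity
      apply mul_left_cancel₀ hn2
      push_cast at h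
      rw [i0, i1] at hrec
      linear_combination hrec - h

/-- The generating function of `n ↦ C_n^μ(t)`. -/
def ultraSeries (mu t : ℝ) : ℝ⟦X⟧ := mk fun n => (ultra mu n).eval t

theorem coeff_prod_ultraSeries {d : ℕ} (mu x : Fin d → ℝ) (n : ℕ) :
    coeff n (∏ i, ultraSeries (mu i) (x i)) =
      ∑ k ∈ Finset.range (n + 1), ∑ β ∈ Finset.piAntidiag (Finset.univ : Finset (Fin d)) k,
        (∏ i, Ring.multichoose (mu i) (β i)) * coeff n (∏ i, shiftSeries (x i) ^ β i) := by
  have h1 : coeff n (∏ i, ultraSeries (mu i) (x i)) = coeff n (∏ i, ∑ k ∈ Finset.range (n + 1),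
      C (Ring.multichoose (mu i) k) * shiftSeries (x i) ^ k) := by
    rw [coeff_prod, coeff_prod]
    refine Finset.sum_congr rfl fun l hl => Finset.prod_congr rfl fun i _ => ?_
    have hle : l i ≤ n := by
      rw [← (Finset.mem_finsuppAntidiag.1 hl).1]
      exact Finset.single_le_sum (f := fun i => l i) (fun _ _ => Nat.zero_le _)
        (Finset.mem_univ i)
    rw [ultraSeries, coeff_mk, ultra_eval_eq_sum (mu i) (x i) hle]
    simp [coeff_C_mul]
  have h2 : ∀ β : Fin d → ℕ, coeff n (∏ i, C (Ring.multichoose (mu i) (β i)) *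
      shiftSeries (x i) ^ β i) =
      (∏ i, Ring.multichoose (mu i) (β i)) * coeff n (∏ i, shiftSeries (x i) ^ β i) := by
    intro β
    rw [Finset.prod_mul_distrib, ← map_prod, coeff_C_mul]
  rw [h1, Finset.prod_univ_sum, map_sum]
  simp only [h2]
  set s := Fintype.piFinset fun _ : Fin d => Finset.range (n + 1)
  rw [← Finset.sum_filter_of_ne (p := fun β : Fin d → ℕ => ∑ i, β i ≤ n)]
  · rw [← Finset.sum_fiberwise_of_maps_to (t := Finset.range (n + 1)) (g := fun β => ∑ i, β i)]
    · refine Finset.sum_congr rfl fun k hk => Finset.sum_congr ?_ fun _ _ => rfl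
      ext β
      simp only [s, Finset.mem_filter, Fintype.mem_piFinset, Finset.mem_range,
        Finset.mem_piAntidiag, Finset.mem_univ, implies_true, and_true]
      have hk' := Finset.mem_range.1 hk
      change _ ∧ ∑ i, β i = k ↔ ∑ i, β i = k
      constructor
      · exact fun h => h.2
      · intro h
        refine ⟨⟨fun i => ?_, by omega⟩, h⟩
        have := Finset.single_le_sum (f := β) (fun _ _ => Nat.zero_le _) (Finset.mem_univ i)
        omega
    · intro β hβ
      exact Finset.mem_range.2 (Nat.lt_succ_iff.2 (Finset.mem_filter.1 hβ).2)
  · intro β _ hne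
    by_contra hlt
    refine hne ?_
    have hd : (X : ℝ⟦X⟧) ^ (∑ i, β i) ∣ ∏ i, shiftSeries (x i) ^ β i := by
      rw [← Finset.prod_pow_eq_pow_sum]
      exact Finset.prod_dvd_prod_of_dvd _ _ fun i _ => pow_dvd_pow_of_dvd
        ⟨C (2 * x i) - X, by rw [shiftSeries]; ring⟩ _
    rw [X_pow_dvd_iff.1 hd n (by omega), mul_zero]

/-- The expansion of `C_n^μ(⟨x, y⟩)` in the monomials of `y`, for `y` with `∑ y_i = 1`: then
`2 r ⟨x, y⟩ - r² = ∑ y_i (2 r x_i - r²)`. -/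
theorem ultra_eval_inner_eq_sum {d : ℕ} (mu : ℝ) (x y : Fin d → ℝ) (hy : ∑ i, y i = 1) (n : ℕ) :
    (ultra mu n).eval (∑ i, x i * y i) =
      ∑ k ∈ Finset.range (n + 1), ∑ β ∈ Finset.piAntidiag (Finset.univ : Finset (Fin d)) k,
        Ring.multichoose mu k * Nat.multinomial Finset.univ β *
          coeff n (∏ i, shiftSeries (x i) ^ β i) * ∏ i, y i ^ β i := by
  rw [ultra_eval_eq_sum mu _ le_rfl]
  refine Finset.sum_congr rfl fun k _ => ?_
  have h : shiftSeries (∑ i, x i * y i) = ∑ i, C (y i) * shiftSeries (x i) := by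
    simp only [shiftSeries, mul_sub, Finset.sum_sub_distrib, ← Finset.sum_mul, ← map_sum, hy,
      ← mul_assoc, ← map_mul, map_one, one_mul, Finset.mul_sum]
    congr 4
    funext i
    ring
  rw [h, Finset.sum_pow_eq_sum_piAntidiag, map_sum, Finset.mul_sum]
  refine Finset.sum_congr rfl fun β _ => ?_
  have e : (Nat.multinomial Finset.univ β : ℝ⟦X⟧) * ∏ i, (C (y i) * shiftSeries (x i)) ^ β i =
      C ((Nat.multinomial Finset.univ β : ℝ) * ∏ i, y i ^ β i) *
        ∏ i, shiftSeries (x i) ^ β i := by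
    simp only [mul_pow, Finset.prod_mul_distrib, map_mul, map_natCast, map_prod, map_pow]
    ring
  rw [e, coeff_C_mul]
  ring

theorem Gamma_add_natCast {s : ℝ} (hs : 0 < s) (k : ℕ) :
    Real.Gamma (s + k) = k.factorial * Ring.multichoose s k * Real.Gamma s := by
  induction k with
  | zero => simp
  | succ k ih =>
    have h := succ_mul_multichoose_succ s k
    rw [Nat.cast_succ, ← add_assoc, Real.Gamma_add_one (by positivity), ih, Nat.factorial_succ]
    push_cast
    linear_combination (-(k.factorial : ℝ) * Real.Gamma s) * h

end GeneratingFunctions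

/-! ### Dirichlet's integral -/

section Dirichlet

open MeasureTheory Set

theorem lintegral_beta {a b : ℝ} (ha : 0 < a) (hb : 0 < b) :
    ∫⁻ u in Ioo (0 : ℝ) 1, ENNReal.ofReal (u ^ (a - 1) * (1 - u) ^ (b - 1)) =
      ENNReal.ofReal (ProbabilityTheory.beta a b) := by
  have h := ProbabilityTheory.lintegral_betaPDF_eq_one ha hb
  have hB := ProbabilityTheory.beta_pos ha hb
  rw [ProbabilityTheory.lintegral_betaPDF] at h
  simp only [mul_assoc, ENNReal.ofReal_mul (one_div_pos.2 hB).le] at h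
  rw [lintegral_const_mul' _ _ ENNReal.ofReal_ne_top] at h
  have h2 : ENNReal.ofReal (ProbabilityTheory.beta a b) *
      ENNReal.ofReal (1 / ProbabilityTheory.beta a b) = 1 := by
    rw [← ENNReal.ofReal_mul hB.le, mul_one_div_cancel hB.ne', ENNReal.ofReal_one]
  rw [← one_mul (lintegral _ _), ← h2, mul_assoc, h, mul_one]

theorem lintegral_beta_scaled {a b s : ℝ} (ha : 0 < a) (hb : 0 < b) (hs : 0 < s) :
    ∫⁻ u in Ioo (0 : ℝ) s, ENNReal.ofReal (u ^ (a - 1) * (s - u) ^ (b - 1)) =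
      ENNReal.ofReal (s ^ (a + b - 1) * ProbabilityTheory.beta a b) := by
  have himg : (fun u : ℝ => s * u) '' Ioo 0 1 = Ioo 0 s := by
    rw [Set.image_mul_left_Ioo hs]; simp
  rw [← himg, lintegral_image_eq_lintegral_abs_deriv_mul measurableSet_Ioo (f' := fun _ => s)
    (fun u _ => by simpa using ((hasDerivAt_id u).const_mul s).hasDerivWithinAt)
    (mul_right_injective₀ hs.ne').injOn]
  have hpow : 0 ≤ s ^ (a + b - 1) := Real.rpow_nonneg hs.le _
  rw [ENNReal.ofReal_mul hpow, ← lintegral_beta ha hb,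
    ← lintegral_const_mul' _ _ ENNReal.ofReal_ne_top]
  refine setLIntegral_congr_fun measurableSet_Ioo fun u hu => ?_
  rw [← ENNReal.ofReal_mul (abs_nonneg _), ← ENNReal.ofReal_mul hpow, abs_of_pos hs,
    Real.mul_rpow hs.le hu.1.le, show s - s * u = s * (1 - u) by ring,
    Real.mul_rpow hs.le (by linarith [hu.2]),
    show a + b - 1 = 1 + (a - 1) + (b - 1) by ring, Real.rpow_add hs, Real.rpow_add hs,
    Real.rpow_one]
  congr 1
  ring

/-- The solid simplex `{y ∈ ℝ^k : y_i ≥ 0, y_1 + ⋯ + y_k ≤ s}` of size `s`. -/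
def scaledSimplex (k : ℕ) (s : ℝ) : Set (Fin k → ℝ) := {y | (∀ i, 0 ≤ y i) ∧ ∑ i, y i ≤ s}

theorem isClosed_scaledSimplex (k : ℕ) (s : ℝ) : IsClosed (scaledSimplex k s) := by
  have h : scaledSimplex k s = (⋂ i, {y | 0 ≤ y i}) ∩ {y | ∑ i, y i ≤ s} := by
    ext y
    simp [scaledSimplex]
  rw [h]
  exact (isClosed_iInter fun i => isClosed_le continuous_const (continuous_apply i)).inter
    (isClosed_le (by fun_prop) continuous_const)

/-- Dirichlet's integral, by induction on the dimension: the integral over the first variable is a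
beta integral, once the size `s` of the simplex is allowed to vary. -/
theorem lintegral_dirichlet {k : ℕ} {a : Fin k → ℝ} (ha : ∀ i, 0 < a i) {b s : ℝ} (hb : 0 < b)
    (hs : 0 < s) :
    ∫⁻ y in scaledSimplex k s,
        ENNReal.ofReal ((∏ i, y i ^ (a i - 1)) * (s - ∑ i, y i) ^ (b - 1)) =
      ENNReal.ofReal (s ^ (∑ i, a i + b - 1) *
        ((∏ i, Real.Gamma (a i)) * Real.Gamma b / Real.Gamma (∑ i, a i + b))) := by
  induction k generalizing s with
  | zero =>
    have hset : scaledSimplex 0 s = univ := by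
      ext y; simp [scaledSimplex, hs.le]
    have hG := (Real.Gamma_pos_of_pos hb).ne'
    rw [hset, Measure.restrict_univ, volume_pi, Measure.pi_of_empty, lintegral_dirac]
    simp [hG]
  | succ k ih =>
    set a' : Fin k → ℝ := fun i => a i.succ
    set K : ℝ := (∏ i, Real.Gamma (a' i)) * Real.Gamma b / Real.Gamma (∑ i, a' i + b) with hK
    have hA : 0 < ∑ i, a' i + b :=
      add_pos_of_nonneg_of_pos (Finset.sum_nonneg fun i _ => (ha _).le) hb
    have hK0 : 0 ≤ K := div_nonneg (mul_nonneg (Finset.prod_nonneg fun i _ =>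
      (Real.Gamma_pos_of_pos (ha _)).le) (Real.Gamma_pos_of_pos hb).le)
      (Real.Gamma_pos_of_pos hA).le
    let F : (Fin (k + 1) → ℝ) → ENNReal := (scaledSimplex (k + 1) s).indicator fun y =>
      ENNReal.ofReal ((∏ i, y i ^ (a i - 1)) * (s - ∑ i, y i) ^ (b - 1))
    have hF : Measurable F := by
      refine Measurable.indicator ?_ (isClosed_scaledSimplex _ _).measurableSet
      fun_prop
    rw [← lintegral_indicator (isClosed_scaledSimplex _ _).measurableSet]
    change ∫⁻ y, F y = _
    rw [← ((volume_preserving_piFinSuccAbove (fun _ : Fin (k + 1) => ℝ) 0).symm _).lintegral_comp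
      hF]
    have hcons : ∀ z : ℝ × (Fin k → ℝ),
        (MeasurableEquiv.piFinSuccAbove (fun _ : Fin (k + 1) => ℝ) 0).symm z =
          Fin.cons z.1 z.2 := by
      intro z
      simp [MeasurableEquiv.piFinSuccAbove_symm_apply, Fin.insertNthEquiv]
    rw [Measure.volume_eq_prod, lintegral_prod
      (fun z => F ((MeasurableEquiv.piFinSuccAbove (fun _ : Fin (k + 1) => ℝ) 0).symm z))
      (hF.comp (MeasurableEquiv.measurable _)).aemeasurable]
    simp only [hcons]
    have hslice : ∀ u ∈ Ioo 0 s, ∫⁻ y, F (Fin.cons u y) =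
        ENNReal.ofReal K *
          ENNReal.ofReal (u ^ (a 0 - 1) * (s - u) ^ (∑ i, a' i + b - 1)) := by
      intro u hu
      have h1 : ∀ y : Fin k → ℝ, F (Fin.cons u y) = (scaledSimplex k (s - u)).indicator (fun y =>
          ENNReal.ofReal (u ^ (a 0 - 1)) *
          ENNReal.ofReal ((∏ i, y i ^ (a' i - 1)) * (s - u - ∑ i, y i) ^ (b - 1))) y := by
        intro y
        have hmem : (Fin.cons u y : Fin (k + 1) → ℝ) ∈ scaledSimplex (k + 1) s ↔
            y ∈ scaledSimplex k (s - u) := by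
          simp only [scaledSimplex, mem_ofPred_eq, Fin.forall_fin_succ, Fin.cons_zero,
            Fin.cons_succ, Fin.sum_univ_succ, hu.1.le, true_and]
          constructor <;> exact fun h => ⟨h.1, by linarith [h.2]⟩
        by_cases hy : y ∈ scaledSimplex k (s - u)
        · simp only [F]
          rw [indicator_of_mem (hmem.2 hy), indicator_of_mem hy,
            ← ENNReal.ofReal_mul (Real.rpow_nonneg hu.1.le _)]
          simp only [Fin.prod_univ_succ, Fin.sum_univ_succ, Fin.cons_zero, Fin.cons_succ, a',
            mul_assoc, sub_sub]
        · simp only [F]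
          rw [indicator_of_notMem (fun h => hy (hmem.1 h)), indicator_of_notMem hy]
      simp only [h1]
      rw [lintegral_indicator (isClosed_scaledSimplex _ _).measurableSet,
        lintegral_const_mul' _ _ ENNReal.ofReal_ne_top,
        ih (fun i => ha i.succ) (by linarith [hu.2] : 0 < s - u), ← hK,
        ← ENNReal.ofReal_mul (Real.rpow_nonneg hu.1.le _), ← ENNReal.ofReal_mul hK0]
      congr 1
      ring
    have houter : ∀ u, u ∉ Icc 0 s → ∫⁻ y, F (Fin.cons u y) = 0 := by
      intro u hu
      have h0 : ∀ y : Fin k → ℝ, F (Fin.cons u y) = 0 := by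
        intro y
        refine indicator_of_notMem (fun h => hu ?_) _
        simp only [scaledSimplex, mem_ofPred_eq, Fin.forall_fin_succ, Fin.cons_zero,
          Fin.cons_succ, Fin.sum_univ_succ] at h
        have := Finset.sum_nonneg fun i (_ : i ∈ Finset.univ) => h.1.2 i
        exact ⟨h.1.1, by linarith [h.2]⟩
      simp only [h0, lintegral_zero]
    rw [← setLIntegral_eq_of_support_subset (s := Icc 0 s), ← setLIntegral_congr Ioo_ae_eq_Icc,
      setLIntegral_congr_fun measurableSet_Ioo hslice,
      lintegral_const_mul' _ _ ENNReal.ofReal_ne_top, lintegral_beta_scaled (ha 0) hA hs,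
      ← ENNReal.ofReal_mul hK0]
    · congr 1
      rw [Fin.sum_univ_succ, Fin.prod_univ_succ, ProbabilityTheory.beta, hK]
      have := (Real.Gamma_pos_of_pos hA).ne'
      simp only [a'] at *
      rw [← add_assoc]
      field_simp
    · intro u hu
      by_contra h
      exact hu (houter u h)

theorem homCoord_castSucc {k : ℕ} (y : Fin (k + 1 - 1) → ℝ) (i : Fin k) :
    homCoord y i.castSucc = y i := by
  simp [homCoord]

theorem homCoord_last {k : ℕ} (y : Fin (k + 1 - 1) → ℝ) :
    homCoord y (Fin.last k) = 1 - ∑ i, y i := by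
  simp [homCoord]

theorem sum_homCoord {d : ℕ} (hd : 1 ≤ d) (y : Fin (d - 1) → ℝ) : ∑ i, homCoord y i = 1 := by
  obtain ⟨k, rfl⟩ : ∃ k, d = k + 1 := ⟨d - 1, by omega⟩
  rw [Fin.sum_univ_castSucc, homCoord_last]
  simp only [homCoord_castSucc]
  exact add_sub_cancel _ _

theorem homCoord_nonneg {d : ℕ} {y : Fin (d - 1) → ℝ} (hy : y ∈ solidSimplex (d - 1))
    (i : Fin d) : 0 ≤ homCoord y i := by
  rw [homCoord]
  split_ifs with h
  · exact hy.1 _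
  · linarith [hy.2]

theorem continuous_homCoord {d : ℕ} : Continuous fun y : Fin (d - 1) → ℝ => homCoord y := by
  refine continuous_pi fun i => ?_
  simp only [homCoord]
  split_ifs with h <;> fun_prop

theorem isCompact_solidSimplex (k : ℕ) : IsCompact (solidSimplex k) := by
  refine (isCompact_Icc (a := (0 : Fin k → ℝ)) (b := 1)).of_isClosed_subset
    (isClosed_scaledSimplex k 1) fun y hy => ⟨hy.1, fun i => ?_⟩
  exact (Finset.single_le_sum (fun j _ => hy.1 j) (Finset.mem_univ i)).trans hy.2

/-- Dirichlet's integral in homogeneous coordinates. -/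
theorem simplexIntegral_dirichlet {d : ℕ} (hd : 1 ≤ d) {e : Fin d → ℝ} (he : ∀ i, 0 < e i) :
    SimplexIntegrable (fun y : Fin d → ℝ => ∏ i, y i ^ (e i - 1)) ∧
      simplexIntegral (fun y : Fin d → ℝ => ∏ i, y i ^ (e i - 1)) =
        (∏ i, Real.Gamma (e i)) / Real.Gamma (∑ i, e i) := by
  obtain ⟨k, rfl⟩ : ∃ k, d = k + 1 := ⟨d - 1, by omega⟩
  have hf : ∀ y : Fin (k + 1 - 1) → ℝ, ∏ i, homCoord y i ^ (e i - 1) =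
      (∏ i : Fin k, y i ^ (e i.castSucc - 1)) * (1 - ∑ i, y i) ^ (e (Fin.last k) - 1) := by
    intro y
    rw [Fin.prod_univ_castSucc, homCoord_last]
    simp only [homCoord_castSucc]
  have hL := lintegral_dirichlet (fun i : Fin k => he i.castSucc) (he (Fin.last k)) one_pos
  rw [Real.one_rpow, one_mul, ← Fin.sum_univ_castSucc (f := e),
    ← Fin.prod_univ_castSucc (f := fun i => Real.Gamma (e i))] at hL
  have hm : AEStronglyMeasurable (fun y : Fin (k + 1 - 1) → ℝ => ∏ i, homCoord y i ^ (e i - 1))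
      (volume.restrict (solidSimplex (k + 1 - 1))) := by
    have : Measurable fun y : Fin (k + 1 - 1) → ℝ => ∏ i, homCoord y i ^ (e i - 1) :=
      Finset.measurable_prod _ fun i _ =>
        ((measurable_pi_apply i).comp continuous_homCoord.measurable).pow_const _
    exact this.aestronglyMeasurable
  have hnn : 0 ≤ᵐ[volume.restrict (solidSimplex (k + 1 - 1))]
      fun y : Fin (k + 1 - 1) → ℝ => ∏ i, homCoord y i ^ (e i - 1) := by
    refine (ae_restrict_iff' (isClosed_scaledSimplex k 1).measurableSet).2 (ae_of_all _ ?_)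
    exact fun y hy => Finset.prod_nonneg fun i _ => Real.rpow_nonneg (homCoord_nonneg hy i) _
  have hL' : ∫⁻ y in solidSimplex (k + 1 - 1),
      ENNReal.ofReal (∏ i, homCoord y i ^ (e i - 1)) =
      ENNReal.ofReal ((∏ i, Real.Gamma (e i)) / Real.Gamma (∑ i, e i)) := by
    simp only [hf]
    exact hL
  refine ⟨(lintegral_ofReal_ne_top_iff_integrable hm hnn).1 ?_, ?_⟩
  · rw [hL']; exact ENNReal.ofReal_ne_top
  · rw [simplexIntegral, integral_eq_lintegral_of_nonneg_ae hnn hm, hL', ENNReal.toReal_ofReal]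
    exact div_nonneg (Finset.prod_nonneg fun i _ => (Real.Gamma_pos_of_pos (he i)).le)
      (Real.Gamma_pos_of_pos (Finset.sum_pos (fun i _ => he i) Finset.univ_nonempty)).le

end Dirichlet

/-! ### Feynman's parametrization and the kernels -/

section Feynman

open MeasureTheory PowerSeries

variable {d : ℕ} {lam : Fin d → ℝ}

theorem simplexIntegrable_mul_rpow (hd : 1 ≤ d) (hlam : ∀ i, -(1 / 2 : ℝ) < lam i)
    {g : (Fin d → ℝ) → ℝ} (hg : Continuous g) :
    SimplexIntegrable fun y : Fin d → ℝ => g y * ∏ i, y i ^ lam i := by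
  have h := (simplexIntegral_dirichlet hd (e := fun i => lam i + 1)
    (fun i => by linarith [hlam i])).1
  simp only [add_sub_cancel_right] at h
  exact IntegrableOn.continuousOn_mul (hg.comp continuous_homCoord).continuousOn h
    (isCompact_solidSimplex _)

/-- The moments `σ_λ ∫ y^β y^λ dy = ∏ (λ_i + 1)_{β_i} / (|λ| + d)_{|β|}` of the Dirichlet
distribution, in the form needed to integrate a multinomial expansion. -/
theorem sigmaConst_mul_simplexIntegral_monomial (hd : 1 ≤ d) (hlam : ∀ i, -(1 / 2 : ℝ) < lam i)
    (β : Fin d → ℕ) :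
    Ring.multichoose (∑ i, lam i + d) (∑ i, β i) * Nat.multinomial Finset.univ β *
        (sigmaConst lam * simplexIntegral fun y : Fin d → ℝ =>
          (∏ i, y i ^ β i) * ∏ i, y i ^ lam i) =
      ∏ i, Ring.multichoose (lam i + 1) (β i) := by
  have hpos : ∀ i, 0 < lam i + 1 := fun i => by linarith [hlam i]
  have hsum : ∑ i, (lam i + 1) = ∑ i, lam i + d := by
    simp [Finset.sum_add_distrib]
  have hs : 0 < ∑ i, lam i + d := by
    rw [← hsum]
    have : Nonempty (Fin d) := ⟨⟨0, hd⟩⟩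
    exact Finset.sum_pos (fun i _ => hpos i) Finset.univ_nonempty
  have h1 : simplexIntegral (fun y : Fin d → ℝ => (∏ i, y i ^ β i) * ∏ i, y i ^ lam i) =
      simplexIntegral fun y : Fin d → ℝ => ∏ i, y i ^ (lam i + 1 + β i - 1) := by
    refine setIntegral_congr_fun (isClosed_scaledSimplex _ 1).measurableSet fun y hy => ?_
    simp only
    rw [← Finset.prod_mul_distrib]
    refine Finset.prod_congr rfl fun i _ => ?_
    have hy0 := homCoord_nonneg hy i
    rw [show lam i + 1 + (β i : ℝ) - 1 = lam i + β i by ring, mul_comm]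
    rcases Nat.eq_zero_or_pos (β i) with h0 | h0
    · simp [h0]
    · have : (1 : ℝ) ≤ β i := by exact_mod_cast h0
      -- At `y_i = 0` the exponents may be added only because `λ_i + β_i ≠ 0`.
      rw [Real.rpow_add' hy0 (by linarith [hlam i]), Real.rpow_natCast]
  have h2 := (simplexIntegral_dirichlet hd (e := fun i => lam i + 1 + β i)
    (fun i => by have := hpos i; positivity)).2
  have h3 : ∑ i, (lam i + 1 + (β i : ℝ)) = ∑ i, lam i + d + (∑ i, β i : ℕ) := by
    rw [Finset.sum_add_distrib, hsum]; push_cast; rfl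
  rw [h1, h2, h3, Gamma_add_natCast hs, sigmaConst]
  simp only [Gamma_add_natCast (hpos _), Finset.prod_mul_distrib]
  have hm : (∏ i, ((β i).factorial : ℝ)) * Nat.multinomial Finset.univ β =
      ((∑ i, β i).factorial : ℝ) := by
    exact_mod_cast Nat.multinomial_spec Finset.univ β
  have n1 : (∏ i, Real.Gamma (lam i + 1)) ≠ 0 :=
    Finset.prod_ne_zero_iff.2 fun i _ => (Real.Gamma_pos_of_pos (hpos i)).ne'
  have n2 := (Real.Gamma_pos_of_pos hs).ne'
  have n3 : (((∑ i, β i).factorial : ℕ) : ℝ) ≠ 0 := by positivity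
  have n4 : Ring.multichoose (∑ i, lam i + d) (∑ i, β i) ≠ 0 := by
    have := (Real.Gamma_pos_of_pos (show 0 < ∑ i, lam i + d + (∑ i, β i : ℕ) by positivity)).ne'
    rw [Gamma_add_natCast hs] at this
    exact (mul_ne_zero_iff.1 (mul_ne_zero_iff.1 this).1).2
  rw [← hm] at n3 ⊢
  have n5 := mul_ne_zero_iff.1 n3
  obtain ⟨n6, n7⟩ := n5
  field_simp

/-- Feynman's parametrization, coefficientwise in `r`: the Dirichlet average of
`(1 - 2 r ⟨x, y⟩ + r²)^(-|λ| - d)` is `∏ (1 - 2 r x_i + r²)^(-λ_i - 1)`. -/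
theorem sigmaConst_mul_simplexIntegral_ultra (hd : 1 ≤ d) (hlam : ∀ i, -(1 / 2 : ℝ) < lam i)
    (x : Fin d → ℝ) (n : ℕ) :
    (sigmaConst lam * simplexIntegral fun y : Fin d → ℝ =>
        (ultra (∑ i, lam i + d) n).eval (∑ i, x i * y i) * ∏ i, y i ^ lam i) =
      coeff n (∏ i, ultraSeries (lam i + 1) (x i)) := by
  have hint : ∀ β : Fin d → ℕ, SimplexIntegrable fun y : Fin d → ℝ =>
      (∏ i, y i ^ β i) * ∏ i, y i ^ lam i := fun β =>
    simplexIntegrable_mul_rpow hd hlam (by fun_prop)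
  have h1 : (simplexIntegral fun y : Fin d → ℝ =>
      (ultra (∑ i, lam i + d) n).eval (∑ i, x i * y i) * ∏ i, y i ^ lam i) =
      ∑ k ∈ Finset.range (n + 1), ∑ β ∈ Finset.piAntidiag (Finset.univ : Finset (Fin d)) k,
        Ring.multichoose (∑ i, lam i + d) k * Nat.multinomial Finset.univ β *
          coeff n (∏ i, shiftSeries (x i) ^ β i) * simplexIntegral fun y : Fin d → ℝ =>
            (∏ i, y i ^ β i) * ∏ i, y i ^ lam i := by
    simp only [simplexIntegral, ultra_eval_inner_eq_sum _ x _ (sum_homCoord hd _),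
      Finset.sum_mul, mul_assoc]
    rw [integral_finsetSum]
    · refine Finset.sum_congr rfl fun k _ => ?_
      rw [integral_finsetSum]
      · refine Finset.sum_congr rfl fun β _ => ?_
        simp only [integral_const_mul]
      · exact fun β _ => (((hint β).const_mul _).const_mul _).const_mul _
    · exact fun k _ => integrable_finsetSum _ fun β _ =>
        (((hint β).const_mul _).const_mul _).const_mul _
  rw [h1, coeff_prod_ultraSeries, Finset.mul_sum]
  refine Finset.sum_congr rfl fun k _ => ?_
  rw [Finset.mul_sum]
  refine Finset.sum_congr rfl fun β hβ => ?_
  have hk : ∑ i, β i = k := (Finset.mem_piAntidiag.1 hβ).1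
  have h := sigmaConst_mul_simplexIntegral_monomial hd hlam β
  rw [hk] at h
  rw [← h]
  ring

/-- The generating function `∑ Z_n^λ(t) r^n = (1 - r²) (1 - 2 r t + r²)^(-λ-1)`. -/
theorem zonalSeries_eq (l t : ℝ) :
    (mk fun n => (zonalPoly l n).eval t) = (1 - X ^ 2) * ultraSeries (l + 1) t := by
  ext n
  rw [sub_mul, one_mul, map_sub, coeff_mk, coeff_X_pow_mul', ultraSeries, coeff_mk]
  match n with
  | 0 => simp [zonalPoly_zero, ultra_zero]
  | 1 => simp [zonalPoly]
  | n + 2 => simp [zonalPoly]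

theorem kernelIntegrand_eq (hpos : 0 < ∑ i, lam i + d - 1) (k : ℕ) (x : Fin d → ℝ) :
    kernelIntegrand lam k x = fun y =>
      (zonalPoly (∑ i, lam i + d - 1) k).eval (∑ i, x i * y i) * ∏ i, y i ^ lam i := by
  funext y
  rw [kernelIntegrand, zonal_eq_eval_zonalPoly hpos]

theorem simplexIntegrable_kernelIntegrand (hd : 1 ≤ d) (hlam : ∀ i, -(1 / 2 : ℝ) < lam i)
    (k : ℕ) (x : Fin d → ℝ) : SimplexIntegrable (kernelIntegrand lam k x) := by
  refine simplexIntegrable_mul_rpow hd hlam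
    (g := fun y => zonal (∑ i, lam i + d - 1) k (∑ i, x i * y i)) ?_
  exact continuous_const.mul ((Polynomial.continuous _).comp (by fun_prop))

/-- The simplex integrals have the generating function `(1 - r²) ∏ (1 - 2 r x_i + r²)^(-λ_i-1)`. -/
theorem simplexIntegralSeries_eq (hd : 1 ≤ d) (hlam : ∀ i, -(1 / 2 : ℝ) < lam i)
    (hpos : 0 < ∑ i, lam i + d - 1) (x : Fin d → ℝ) :
    (mk fun k => sigmaConst lam * simplexIntegral (kernelIntegrand lam k x)) =
      (1 - X ^ 2) * ∏ i, ultraSeries (lam i + 1) (x i) := by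
  ext n
  have hU := sigmaConst_mul_simplexIntegral_ultra hd hlam x
  rw [sub_mul, one_mul, map_sub, coeff_mk, coeff_X_pow_mul', kernelIntegrand_eq hpos]
  match n with
  | 0 => simp only [zonalPoly_zero, ← hU, ultra_zero]; simp
  | 1 => simp only [zonalPoly, ← hU, sub_add_cancel]; simp
  | n + 2 =>
    simp only [zonalPoly, sub_add_cancel, Polynomial.eval_sub, sub_mul]
    rw [if_pos (by omega), Nat.add_sub_cancel, ← hU, ← hU, ← mul_sub]
    congr 1
    have hint : ∀ m, SimplexIntegrable fun y : Fin d → ℝ =>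
        (ultra (∑ i, lam i + d) m).eval (∑ i, x i * y i) * ∏ i, y i ^ lam i := fun m =>
      simplexIntegrable_mul_rpow hd hlam
        (g := fun y => (ultra (∑ i, lam i + d) m).eval (∑ i, x i * y i))
        ((Polynomial.continuous _).comp (by fun_prop))
    exact integral_sub (hint _) (hint _)

/-- The generating function of the kernels is `∏ (1 - r²) / (1 - 2 r x_i + r²)^(λ_i + 1)`. -/
theorem reproKernelSeries_eq (hlam : ∀ i, -(1 / 2 : ℝ) < lam i) (x : Fin d → ℝ) :
    (mk fun n => reproKernel (prodWeight lam) n x 1) =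
      (1 - X ^ 2) ^ d * ∏ i, ultraSeries (lam i + 1) (x i) := by
  have h : (1 - X ^ 2) ^ d * ∏ i, ultraSeries (lam i + 1) (x i) =
      ∏ i, mk fun n => (zonalPoly (lam i) n).eval (x i) := by
    simp only [zonalSeries_eq, Finset.prod_mul_distrib, Finset.prod_const, Finset.card_univ,
      Fintype.card_fin]
  rw [h]
  ext n
  rw [coeff_mk, reproKernel_prodWeight_one hlam, coeff_prod]
  simp only [coeff_mk]

theorem coeff_one_add_C_mul_X_pow_pow_mul (c : ℝ) {e : ℕ} (he : 0 < e) (D n : ℕ) (G : ℝ⟦X⟧) :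
    coeff n ((1 + C c * X ^ e) ^ D * G) =
      ∑ m ∈ Finset.range (min (n / e) D + 1),
        c ^ m * (D.choose m : ℝ) * coeff (n - e * m) G := by
  have h1 : (1 + C c * X ^ e) ^ D * G =
      ∑ m ∈ Finset.range (D + 1), C (c ^ m * (D.choose m : ℝ)) * (X ^ (e * m) * G) := by
    rw [add_comm, add_pow, Finset.sum_mul]
    refine Finset.sum_congr rfl fun m _ => ?_
    simp only [one_pow, mul_one, mul_pow, map_mul, map_pow, map_natCast, pow_mul]
    ring
  rw [h1, map_sum]
  simp only [coeff_C_mul, coeff_X_pow_mul']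
  symm
  have hiff : ∀ m, e * m ≤ n ↔ m ≤ n / e := fun m => by
    rw [Nat.le_div_iff_mul_le he, mul_comm]
  refine (Finset.sum_congr rfl fun m hm => ?_).trans (Finset.sum_subset (s₁ :=
    Finset.range (min (n / e) D + 1)) (fun m hm => ?_) fun m hm hm' => ?_)
  · have := Finset.mem_range.1 hm
    rw [if_pos ((hiff m).2 (by omega))]
  · rw [Finset.mem_range] at *
    omega
  · rw [Finset.mem_range] at *
    rw [if_neg (fun h => hm' (by have := (hiff m).1 h; omega)), mul_zero]

theorem choose_add_sub_two {d : ℕ} (hd : 2 ≤ d) (m : ℕ) :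
    Ring.choose ((m : ℝ) + ((d : ℝ) - 2)) m = ((m + d - 2).choose m : ℝ) := by
  rw [← Ring.choose_natCast, Nat.cast_sub (by omega)]
  push_cast
  ring_nf

end Feynman

end

end GegenbauerKernel

theorem theorem3p1 (d : ℕ) (hd : 2 ≤ d) (lam : Fin d → ℝ) (hlam : ∀ i, -(1 / 2 : ℝ) < lam i)
    (n : ℕ) (x : Fin d → ℝ) (hx : x ∈ Set.Icc (-1 : Fin d → ℝ) 1) :
    (∀ k : ℕ, SimplexIntegrable (kernelIntegrand lam k x)) ∧
    reproKernel (prodWeight lam) n x 1 =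
      ∑ m ∈ Finset.range (min (n / 2) (d - 1) + 1),
        (-1 : ℝ) ^ m * ((d - 1).choose m : ℝ) *
          (sigmaConst lam * simplexIntegral (kernelIntegrand lam (n - 2 * m) x)) ∧
    cesaroKernel (prodWeight lam) ((d : ℝ) - 2) n x 1 =
      1 / ((n + d - 2).choose n : ℝ) *
        ∑ m ∈ Finset.range (min n (d - 1) + 1),
          ((d - 1).choose m : ℝ) *
            (sigmaConst lam * simplexIntegral (kernelIntegrand lam (n - m) x)) := by
  have hpos : 0 < ∑ i, lam i + d - 1 := by
    have : Nonempty (Fin d) := ⟨⟨0, by omega⟩⟩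
    have h : ∑ _i : Fin d, (-(1 / 2) : ℝ) < ∑ i, lam i :=
      Finset.sum_lt_sum_of_nonempty Finset.univ_nonempty fun i _ => hlam i
    have hd' : (2 : ℝ) ≤ d := by exact_mod_cast hd
    simp only [Finset.sum_const, Finset.card_univ, Fintype.card_fin, nsmul_eq_mul] at h
    linarith
  set G : PowerSeries ℝ :=
    PowerSeries.mk fun k => sigmaConst lam * simplexIntegral (kernelIntegrand lam k x) with hG
  have hP : (PowerSeries.mk fun n => reproKernel (prodWeight lam) n x 1) =
      (1 - PowerSeries.X ^ 2) ^ (d - 1) * G := by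
    rw [reproKernelSeries_eq hlam, hG, simplexIntegralSeries_eq (by omega) hlam hpos, ← mul_assoc,
      ← pow_succ, Nat.sub_add_cancel (by omega)]
  refine ⟨fun k => simplexIntegrable_kernelIntegrand (by omega) hlam k x, ?_, ?_⟩
  · have h := congrArg (PowerSeries.coeff n) hP
    rw [PowerSeries.coeff_mk, show (1 - PowerSeries.X ^ 2 : PowerSeries ℝ) =
      1 + PowerSeries.C (-1) * PowerSeries.X ^ 2 by simp [sub_eq_add_neg],
      coeff_one_add_C_mul_X_pow_pow_mul _ two_pos] at h
    simpa only [hG, PowerSeries.coeff_mk] using h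
  · have hone : (PowerSeries.mk 1 : PowerSeries ℝ) * (1 - PowerSeries.X ^ 2) =
        1 + PowerSeries.C 1 * PowerSeries.X ^ 1 := by
      have := PowerSeries.mk_one_mul_one_sub_eq_one ℝ
      rw [map_one, one_mul, pow_one]
      linear_combination (1 + PowerSeries.X) * this
    -- Cesàro summation multiplies the generating function by `(1 - r)^(1 - d)`.
    have hmul : (PowerSeries.mk 1 : PowerSeries ℝ) ^ (d - 1) *
        (PowerSeries.mk fun n => reproKernel (prodWeight lam) n x 1) =
        (1 + PowerSeries.C 1 * PowerSeries.X ^ 1) ^ (d - 1) * G := by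
      rw [hP, ← mul_assoc, ← mul_pow, hone]
    have h := congrArg (PowerSeries.coeff n) hmul
    have hd1 : d - 1 = d - 2 + 1 := by omega
    rw [coeff_one_add_C_mul_X_pow_pow_mul _ one_pos, hd1, PowerSeries.mk_one_pow_eq_mk_choose_add,
      ← hd1, mul_comm, PowerSeries.coeff_mul,
      Finset.Nat.sum_antidiagonal_eq_sum_range_succ_mk] at h
    simp only [hG, PowerSeries.coeff_mk, one_pow, one_mul, Nat.div_one] at h
    rw [cesaroKernel, choose_add_sub_two hd, ← h]
    congr 1
    refine Finset.sum_congr rfl fun k _ => ?_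
    rw [choose_add_sub_two hd, mul_comm, show n - k + d - 2 = d - 2 + (n - k) by omega,
      Nat.choose_symm_add]
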